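/- Let $G$ be a finite simple planar graph, that is, a finite simple graph that can be drawn in the plane with its vertices as distinct points and its edges as simple polygonal arcs joining their end vertices, such that the interior of each edge contains no vertex and no point of another edge. Suppose that no two distinct triangles (cycles of length $3$) of $G$ have a common vertex, and that every triangle of $G$ shares an edge with at most one cycle of length $4$ of $G$. Then $\operatorname{mad}(G) < 4$, where $$\operatorname{mad}(G) = \max\left\{\frac{2|E(H)|}{|V(H)|} : H \text{ is a subgraph of } G \text{ with at least one vertex}\right\}$$ is the maximum average degree of $G$. -/

import Mathlib

namespace PlanarMad

/-- The real plane. Only its affine structure is used below. -/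
abbrev Plane : Type := ℝ × ℝ

/-- A simple polygonal arc in the plane: finitely many (at least one) straight line segments
`[pt 0, pt 1], [pt 1, pt 2], …, [pt (n-1), pt n]`, such that two different segments are disjoint,
except that consecutive segments share exactly their common end. -/
structure PolygonalArc where
  /-- the number of segments -/
  n : ℕ
  n_pos : 0 < n
  /-- the successive corners of the arc, including its two ends -/
  pt : Fin (n + 1) → Plane
  pt_injective : Function.Injective pt
  /-- A point on two segments `i < j` is the last point of `i` and the first point of `j`
  (so, `pt` being injective, `j` is the successor of `i`). -/
  simple : ∀ i j : Fin n, i < j →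
    ∀ x ∈ segment ℝ (pt i.castSucc) (pt i.succ), x ∈ segment ℝ (pt j.castSucc) (pt j.succ) →
      x = pt i.succ ∧ x = pt j.castSucc

/-- The set of points of a polygonal arc. -/
def PolygonalArc.carrier (A : PolygonalArc) : Set Plane :=
  ⋃ i : Fin A.n, segment ℝ (A.pt i.castSucc) (A.pt i.succ)

/-- The unordered pair of ends of a polygonal arc. -/
def PolygonalArc.ends (A : PolygonalArc) : Sym2 Plane :=
  s(A.pt 0, A.pt (Fin.last A.n))

/-- A drawing (embedding) of the graph `G` in the plane: the vertices are distinct points, every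
edge is a polygonal arc between its end vertices, the interior of an edge contains no vertex and no
point of any other edge. -/
structure PlaneDrawing {V : Type*} (G : SimpleGraph V) where
  /-- the point representing a vertex -/
  point : V → Plane
  point_injective : Function.Injective point
  /-- the arc representing an edge -/
  arc : G.edgeSet → PolygonalArc
  arc_ends : ∀ e : G.edgeSet, (arc e).ends = (e : Sym2 V).map point
  /-- an arc passes through no vertices other than its ends -/
  mem_of_point_mem_arc : ∀ (e : G.edgeSet) (v : V), point v ∈ (arc e).carrier → v ∈ (e : Sym2 V)
  /-- two different arcs meet only in common end vertices -/
  arc_inter : ∀ e f : G.edgeSet, e ≠ f → ∀ x ∈ (arc e).carrier, x ∈ (arc f).carrier →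
    ∃ v : V, v ∈ (e : Sym2 V) ∧ v ∈ (f : Sym2 V) ∧ x = point v

/-- A graph is planar if it can be drawn in the plane without crossings. -/
def IsPlanar {V : Type*} (G : SimpleGraph V) : Prop :=
  Nonempty (PlaneDrawing G)

/-- The subgraph `C` of `G` is a cycle of length `k`. -/
def IsCycleOfLength {V : Type*} {G : SimpleGraph V} (k : ℕ) (C : G.Subgraph) : Prop :=
  ∃ (u : V) (w : G.Walk u u), w.IsCycle ∧ w.length = k ∧ C = w.toSubgraph

/-- A triangle of `G` is a cycle of length three. -/
def IsTriangle {V : Type*} {G : SimpleGraph V} (C : G.Subgraph) : Prop :=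
  IsCycleOfLength 3 C

/-- Two cycles intersect if they have at least one common vertex. -/
def Intersecting {V : Type*} {G : SimpleGraph V} (C D : G.Subgraph) : Prop :=
  (C.verts ∩ D.verts).Nonempty

/-- Two cycles are adjacent if they share a common edge. -/
def Adjacent {V : Type*} {G : SimpleGraph V} (C D : G.Subgraph) : Prop :=
  (C.edgeSet ∩ D.edgeSet).Nonempty

/-- The average degree `2|E(H)| / |V(H)|` of a (finite) subgraph `H`. -/
noncomputable def averageDegree {V : Type*} {G : SimpleGraph V} (H : G.Subgraph) : ℝ :=
  2 * (H.edgeSet.ncard : ℝ) / (H.verts.ncard : ℝ)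

/-- The maximum average degree of a finite graph: the maximum (see `isGreatest_mad`) of the average
degrees of its subgraphs with at least one vertex. -/
noncomputable def mad {V : Type*} (G : SimpleGraph V) : ℝ :=
  sSup {d : ℝ | ∃ H : G.Subgraph, H.verts.Nonempty ∧ d = averageDegree H}

/-- For a finite graph with at least one vertex, the supremum in `mad` is a maximum. -/
theorem isGreatest_mad {V : Type*} [Finite V] [Nonempty V] (G : SimpleGraph V) :
    IsGreatest {d : ℝ | ∃ H : G.Subgraph, H.verts.Nonempty ∧ d = averageDegree H} (mad G) := by
  have hfin : {d : ℝ | ∃ H : G.Subgraph, H.verts.Nonempty ∧ d = averageDegree H}.Finite := by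
    refine (Set.finite_range fun H : G.Subgraph => averageDegree H).subset ?_
    rintro d ⟨H, -, rfl⟩
    exact ⟨H, rfl⟩
  have hne : {d : ℝ | ∃ H : G.Subgraph, H.verts.Nonempty ∧ d = averageDegree H}.Nonempty :=
    ⟨_, ⊤, Set.univ_nonempty, rfl⟩
  exact ⟨hne.csSup_mem hfin, fun d hd => le_csSup hfin.bddAbove hd⟩

end PlanarMad

/-! Take the classes of the edges in the edge space modulo two divided by the cut space. Around
every vertex they sum to zero. Shear the drawing so that no segment is vertical; the sum of the
classes that an upward vertical ray crosses then stays constant along either side of an edge. The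
values that occur serve as faces: the boundary of a face is an even edge set, and as the classes
span the quotient, `|V| - |E| + |F| ≥ 2`. This half of Euler's formula suffices, and it needs no
Jordan curve theorem. In a `3`-edge-connected graph different edges have different classes, so that
two faces share at most one edge.

Then discharge: a triangular face has at least two neighbours of length at least five, and the
triangular neighbours of a face of length `d` use disjoint edges of it, so that there are at most
`d / 2` of them. Hence `2|F| ≤ |E|`, and `|E| ≤ 2|V| - 4`. If `G` is not `3`-edge-connected,
induction on both sides of a cut of at most two edges still gives `|E| ≤ 2|V| - 2`. The base case
is a single vertex, and the bound passes to all subgraphs. -/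

namespace PlanarMad

open Finset

open scoped Classical in
theorem sum_telescope_of_injOn {S W B : Type*} [AddCommGroup W] [AddCommGroup B] (g : W → B)
    (ζ : S → W) (κ : S → ℝ) (U : W) (R : Finset S) (hκ : Set.InjOn κ R) :
    ∑ s ∈ R, (g (U + ∑ t ∈ R with κ s < κ t, ζ t) - g (U + ∑ t ∈ R with κ s < κ t, ζ t + ζ s)) =
      g U - g (U + ∑ t ∈ R, ζ t) := by
  induction R using Finset.induction_on_min_value κ with
  | empty => simp
  | insert a R ha hmin ih =>
    have hlt : ∀ t ∈ R, κ a < κ t := fun t ht => (hmin t ht).lt_of_ne fun h =>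
      ha (hκ (by simp) (by simp [ht]) h ▸ ht)
    have above_a : {t ∈ insert a R | κ a < κ t} = R := by
      rw [filter_insert, if_neg (lt_irrefl _), filter_true_of_mem hlt]
    have above_of_mem : ∀ s ∈ R, {t ∈ insert a R | κ s < κ t} = {t ∈ R | κ s < κ t} := fun s hs =>
      by rw [filter_insert, if_neg (hlt s hs).not_gt]
    have rest : ∑ s ∈ R, (g (U + ∑ t ∈ insert a R with κ s < κ t, ζ t) -
        g (U + ∑ t ∈ insert a R with κ s < κ t, ζ t + ζ s)) = g U - g (U + ∑ t ∈ R, ζ t) := by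
      rw [← ih (hκ.mono (by simp))]
      exact sum_congr rfl fun s hs => by rw [above_of_mem s hs]
    rw [sum_insert ha, sum_insert ha, above_a, rest, add_assoc U, add_comm _ (ζ a)]
    abel

/-- A family of `x`-monotone arcs: graphs of continuous functions over compact intervals, two of
which meet at most in common end points. -/
structure MonotoneArcs (S : Type*) where
  left : S → ℝ
  right : S → ℝ
  height : S → ℝ → ℝ
  left_lt_right : ∀ s, left s < right s
  continuousOn_height : ∀ s, ContinuousOn (height s) (Set.Icc (left s) (right s))
  height_ne : ∀ s t, s ≠ t → ∀ x ∈ Set.Ioo (left s) (right s), x ∈ Set.Icc (left t) (right t) →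
    height s x ≠ height t x

namespace MonotoneArcs

variable {S : Type*} (M : MonotoneArcs S)

/-- The left end point of an arc. -/
def leftEnd (s : S) : Plane := (M.left s, M.height s (M.left s))

/-- The right end point of an arc. -/
def rightEnd (s : S) : Plane := (M.right s, M.height s (M.right s))

theorem height_lt_iff_of_ne {s t : S} {I : Set ℝ} (hI : I.OrdConnected)
    (hIs : I ⊆ Set.Icc (M.left s) (M.right s)) (hIt : I ⊆ Set.Icc (M.left t) (M.right t))
    (hne : ∀ z ∈ I, M.height s z ≠ M.height t z) {x y : ℝ} (hx : x ∈ I) (hy : y ∈ I) :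
    M.height s x < M.height t x ↔ M.height s y < M.height t y := by
  have hlt : ∀ {x y}, x ∈ I → y ∈ I → M.height s x < M.height t x →
      M.height s y < M.height t y := by
    intro x y hx hy hxlt
    by_contra hylt
    obtain ⟨z, hz, heq⟩ := hI.isPreconnected.intermediate_value₂ hx hy
      ((M.continuousOn_height s).mono hIs) ((M.continuousOn_height t).mono hIt) hxlt.le
      (not_lt.1 hylt)
    exact hne z hz heq
  exact ⟨hlt hx hy, hlt hy hx⟩

theorem height_lt_iff_of_mem_Ioo {s t : S} {x y : ℝ} (hx : x ∈ Set.Ioo (M.left s) (M.right s))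
    (hy : y ∈ Set.Ioo (M.left s) (M.right s)) (hx' : x ∈ Set.Icc (M.left t) (M.right t))
    (hy' : y ∈ Set.Icc (M.left t) (M.right t)) :
    M.height s x < M.height t x ↔ M.height s y < M.height t y := by
  rcases eq_or_ne s t with rfl | hst
  · simp
  · exact M.height_lt_iff_of_ne (Set.ordConnected_Ioo.inter Set.ordConnected_Icc)
      (Set.inter_subset_left.trans Set.Ioo_subset_Icc_self) Set.inter_subset_right
      (fun z hz => M.height_ne s t hst z hz.1 hz.2) ⟨hx, hx'⟩ ⟨hy, hy'⟩

theorem height_lt_iff_leftEnd {s t : S} {x : ℝ} (hx : x ∈ Set.Ioo (M.left s) (M.right s))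
    (hleft : M.left s ∈ Set.Ico (M.left t) (M.right t)) (hx' : x ∈ Set.Icc (M.left t) (M.right t))
    (hst : M.leftEnd t ≠ M.leftEnd s) :
    M.height s x < M.height t x ↔ (M.leftEnd s).2 < M.height t (M.left s) := by
  have hne : ∀ z ∈ Set.Icc (M.left s) x, M.height s z ≠ M.height t z := by
    have hst' : s ≠ t := fun h => hst (h ▸ rfl)
    intro z hz heq
    rcases hz.1.eq_or_lt with rfl | hlt
    · rcases hleft.1.eq_or_lt with hleft' | hlt
      · exact hst (by rw [leftEnd, leftEnd, heq, hleft'])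
      · exact M.height_ne t s hst'.symm _ ⟨hlt, hleft.2⟩
          (Set.left_mem_Icc.2 (M.left_lt_right s).le) heq.symm
    · exact M.height_ne s t hst' z ⟨hlt, hz.2.trans_lt hx.2⟩
        ⟨hleft.1.trans hz.1, hz.2.trans hx'.2⟩ heq
  exact M.height_lt_iff_of_ne Set.ordConnected_Icc (Set.Icc_subset_Icc_right hx.2.le)
    (Set.Icc_subset_Icc hleft.1 hx'.2) hne (Set.right_mem_Icc.2 hx.1.le)
    (Set.left_mem_Icc.2 hx.1.le)

/-- The mirror image of a family of arcs under `(x, y) ↦ (-x, y)`. -/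
def reflect : MonotoneArcs S where
  left s := -M.right s
  right s := -M.left s
  height s x := M.height s (-x)
  left_lt_right s := neg_lt_neg (M.left_lt_right s)
  continuousOn_height s := (M.continuousOn_height s).comp continuousOn_neg fun _ hx =>
    ⟨le_neg.2 hx.2, neg_le.2 hx.1⟩
  height_ne s t hst x hx hx' := M.height_ne s t hst (-x) ⟨lt_neg.2 hx.2, neg_lt.2 hx.1⟩
    ⟨le_neg.2 hx'.2, neg_le.2 hx'.1⟩

variable {M} in
theorem leftEnd_reflect_eq_iff {s : S} {v : Plane} :
    M.reflect.leftEnd s = v ↔ M.rightEnd s = (-v.1, v.2) := by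
  simp [leftEnd, rightEnd, reflect, Prod.ext_iff, neg_eq_iff_eq_neg]

variable {M} in
theorem rightEnd_reflect_eq_iff {s : S} {v : Plane} :
    M.reflect.rightEnd s = v ↔ M.leftEnd s = (-v.1, v.2) := by
  simp [leftEnd, rightEnd, reflect, Prod.ext_iff, neg_eq_iff_eq_neg]

variable [Fintype S] {W B : Type*} [AddCommGroup W] [AddCommGroup B] {ζ : S → W}

open scoped Classical in
/-- An assignment of a group element to every arc, directed from left to right, for which the
inflow and the outflow at every point agree. -/
def IsFlow (ζ : S → W) : Prop :=
  ∀ v, ∑ s with M.leftEnd s = v, ζ s = ∑ s with M.rightEnd s = v, ζ s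

open scoped Classical in
/-- The amount of `ζ` that crosses the vertical ray above `v`. A crossing in an end point of an
arc counts if that end point is the left one. -/
noncomputable def potential (ζ : S → W) (v : Plane) : W :=
  ∑ t with M.left t ≤ v.1 ∧ v.1 < M.right t ∧ v.2 < M.height t v.1, ζ t

/-- The potential of the region just above an arc. -/
noncomputable def upperLabel (ζ : S → W) (s : S) : W :=
  M.potential ζ ((M.left s + M.right s) / 2, M.height s ((M.left s + M.right s) / 2))

variable {M}

theorem IsFlow.sum_leftEnd_mem (hζ : M.IsFlow ζ) (R : Set Plane) [DecidablePred (· ∈ R)] :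
    ∑ s with M.leftEnd s ∈ R, ζ s = ∑ s with M.rightEnd s ∈ R, ζ s := by
  classical
  let Q := {q ∈ univ.image M.leftEnd ∪ univ.image M.rightEnd | q ∈ R}
  have sum_mem (e : S → Plane) (he : ∀ s, e s ∈ R → e s ∈ Q) :
      ∑ s with e s ∈ R, ζ s = ∑ q ∈ Q, ∑ s with e s = q, ζ s := by
    rw [← sum_fiberwise_of_maps_to (t := Q) fun s hs => he s (mem_filter.1 hs).2]
    refine sum_congr rfl fun q hq => ?_
    rw [filter_filter]
    refine sum_congr (filter_congr fun s _ => and_iff_right_of_imp ?_) fun _ _ => rfl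
    rintro rfl
    exact (mem_filter.1 hq).2
  rw [sum_mem M.leftEnd (by simp [Q]), sum_mem M.rightEnd (by simp [Q])]
  exact sum_congr rfl fun q _ => hζ q

theorem IsFlow.potential_eq_of_lt (hζ : M.IsFlow ζ) {s : S} {x y : ℝ}
    (hx : x ∈ Set.Ioo (M.left s) (M.right s)) (hy : y ∈ Set.Ioo (M.left s) (M.right s))
    (hxy : x < y) :
    M.potential ζ (x, M.height s x) = M.potential ζ (y, M.height s y) := by
  classical
  let strip : Set Plane := {q | x < q.1 ∧ q.1 ≤ y ∧ M.height s q.1 < q.2}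
  let Above (t : S) : Prop := ∃ z ∈ Set.Icc x y, z ∈ Set.Icc (M.left t) (M.right t) ∧
    M.height s z < M.height t z
  have above_iff (t : S) {z : ℝ} (hz : z ∈ Set.Icc x y) (hzt : z ∈ Set.Icc (M.left t) (M.right t)) :
      Above t ↔ M.height s z < M.height t z :=
    have hIoo : Set.Icc x y ⊆ Set.Ioo (M.left s) (M.right s) := Set.Icc_subset_Ioo hx.1 hy.2
    ⟨fun ⟨_, hw, hwt, hlt⟩ => (M.height_lt_iff_of_mem_Ioo (hIoo hz) (hIoo hw) hzt hwt).2 hlt,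
      fun h => ⟨z, hz, hzt, h⟩⟩
  -- Both sides are the flow through the part of the strip above `s`, less what begins there,
  -- or what ends there.
  have enter : M.potential ζ (x, M.height s x) + ∑ t with M.leftEnd t ∈ strip, ζ t =
      ∑ t with M.left t ≤ y ∧ x < M.right t ∧ Above t, ζ t := by
    rw [← sum_filter_add_sum_filter_not {t | M.left t ≤ y ∧ x < M.right t ∧ Above t}
      (fun t => M.left t ≤ x), filter_filter, filter_filter]
    congr 1 <;> refine sum_congr (filter_congr fun t _ => ?_) fun _ _ => rfl
    · have := above_iff t (z := x) (Set.left_mem_Icc.2 hxy.le)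
      grind
    · have := above_iff t (z := M.left t)
      have := M.left_lt_right t
      grind [leftEnd]
  have leave : M.potential ζ (y, M.height s y) + ∑ t with M.rightEnd t ∈ strip, ζ t =
      ∑ t with M.left t ≤ y ∧ x < M.right t ∧ Above t, ζ t := by
    rw [← sum_filter_add_sum_filter_not {t | M.left t ≤ y ∧ x < M.right t ∧ Above t}
      (fun t => y < M.right t), filter_filter, filter_filter]
    congr 1 <;> refine sum_congr (filter_congr fun t _ => ?_) fun _ _ => rfl
    · have := above_iff t (z := y) (Set.right_mem_Icc.2 hxy.le)
      grind
    · have := above_iff t (z := M.right t)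
      have := M.left_lt_right t
      grind [rightEnd]
  rw [← enter, hζ.sum_leftEnd_mem strip] at leave
  exact (add_right_cancel leave).symm

theorem IsFlow.upperLabel_eq (hζ : M.IsFlow ζ) {s : S} {x : ℝ}
    (hx : x ∈ Set.Ioo (M.left s) (M.right s)) :
    M.upperLabel ζ s = M.potential ζ (x, M.height s x) := by
  have hmid : (M.left s + M.right s) / 2 ∈ Set.Ioo (M.left s) (M.right s) := by
    have := M.left_lt_right s
    constructor <;> linarith
  rcases lt_trichotomy ((M.left s + M.right s) / 2) x with h | h | h
  · exact hζ.potential_eq_of_lt hmid hx h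
  · rw [upperLabel, h]
  · exact (hζ.potential_eq_of_lt hx hmid h).symm

open scoped Classical in
theorem potential_eq_add_of_leftEnd {s : S} {x : ℝ} (hx : M.left s < x)
    (hl : ∀ t, M.left s < M.left t → x < M.left t)
    (hr : ∀ t, M.left s < M.right t → x < M.right t) :
    M.potential ζ (x, M.height s x) = M.potential ζ (M.leftEnd s) +
      ∑ t with M.leftEnd t = M.leftEnd s ∧ M.height s x < M.height t x, ζ t := by
  have hxs : x ∈ Set.Ioo (M.left s) (M.right s) := ⟨hx, hr s (M.left_lt_right s)⟩
  rw [potential, ← sum_filter_not_add_sum_filter _ (fun t => M.leftEnd t = M.leftEnd s),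
    filter_filter, filter_filter]
  congr 1 <;> refine sum_congr (filter_congr fun t _ => ?_) fun _ _ => rfl
  · have := M.height_lt_iff_leftEnd (t := t) hxs
    have := hl t
    have := hr t
    grind [leftEnd]
  · have := hr t
    have := M.left_lt_right t
    grind [leftEnd]

open scoped Classical in
theorem IsFlow.sum_leftEnd_eq (hζ : M.IsFlow ζ) (g : W → B) (v : Plane) :
    ∑ s with M.leftEnd s = v, (g (M.upperLabel ζ s) - g (M.upperLabel ζ s + ζ s)) =
      g (M.potential ζ v) - g (M.potential ζ v + ∑ s with M.leftEnd s = v, ζ s) := by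
  obtain ⟨x, hx, hlr⟩ := (Set.finite_singleton v.1).exists_between'
    ((Set.finite_range (Sum.elim M.left M.right)).inter_of_left (Set.Ioi v.1))
    (by rintro _ rfl _ ⟨-, hlt⟩; exact hlt)
  replace hx : v.1 < x := hx _ rfl
  replace hlr : ∀ i, v.1 < Sum.elim M.left M.right i → x < Sum.elim M.left M.right i :=
    fun i hi => hlr _ ⟨⟨i, rfl⟩, hi⟩
  have hxs : ∀ s, M.leftEnd s = v → x ∈ Set.Ioo (M.left s) (M.right s) := by
    rintro s rfl
    exact ⟨hx, hlr (Sum.inr s) (M.left_lt_right s)⟩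
  have upperLabel_eq : ∀ s, M.leftEnd s = v → M.upperLabel ζ s = M.potential ζ v +
      ∑ t ∈ {t | M.leftEnd t = v} with M.height s x < M.height t x, ζ t := by
    rintro s rfl
    rw [hζ.upperLabel_eq (hxs s rfl), filter_filter]
    exact potential_eq_add_of_leftEnd hx (fun t => hlr (Sum.inl t)) (fun t => hlr (Sum.inr t))
  rw [← sum_telescope_of_injOn g ζ (fun s => M.height s x)]
  · exact sum_congr rfl fun s hs => by rw [upperLabel_eq s (by simpa using hs)]
  · intro s hs t ht heq
    by_contra hst
    exact M.height_ne s t hst x (hxs s (by simpa using hs))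
      (Set.Ioo_subset_Icc_self (hxs t (by simpa using ht))) heq

theorem IsFlow.reflect (hζ : M.IsFlow ζ) : M.reflect.IsFlow ζ := by
  intro v
  simpa only [leftEnd_reflect_eq_iff, rightEnd_reflect_eq_iff] using (hζ (-v.1, v.2)).symm

open scoped Classical in
theorem IsFlow.potential_reflect (hζ : M.IsFlow ζ) (v : Plane) :
    M.reflect.potential ζ (-v.1, v.2) = M.potential ζ v := by
  let ray : Set Plane := {q | q.1 = v.1 ∧ v.2 < q.2}
  have above_eq : M.potential ζ v =
      ∑ t with M.left t < v.1 ∧ v.1 < M.right t ∧ v.2 < M.height t v.1, ζ t +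
        ∑ t with M.leftEnd t ∈ ray, ζ t := by
    rw [potential, ← sum_filter_not_add_sum_filter _ (fun t => M.left t = v.1), filter_filter,
      filter_filter]
    congr 1 <;> refine sum_congr (filter_congr fun t _ => ?_) fun _ _ => rfl
    · grind
    · have := M.left_lt_right t
      grind [leftEnd]
  have above_reflect_eq : M.reflect.potential ζ (-v.1, v.2) =
      ∑ t with M.left t < v.1 ∧ v.1 < M.right t ∧ v.2 < M.height t v.1, ζ t +
        ∑ t with M.rightEnd t ∈ ray, ζ t := by
    rw [potential, ← sum_filter_not_add_sum_filter _ (fun t => M.right t = v.1), filter_filter,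
      filter_filter]
    congr 1 <;> refine sum_congr (filter_congr fun t _ => ?_) fun _ _ => rfl
    · simp only [MonotoneArcs.reflect, neg_le_neg_iff, neg_lt_neg_iff, neg_neg]
      grind
    · have := M.left_lt_right t
      simp only [MonotoneArcs.reflect, neg_le_neg_iff, neg_lt_neg_iff, neg_neg]
      grind [rightEnd]
  rw [above_eq, above_reflect_eq, hζ.sum_leftEnd_mem ray]

theorem IsFlow.upperLabel_reflect (hζ : M.IsFlow ζ) (s : S) :
    M.reflect.upperLabel ζ s = M.upperLabel ζ s := by
  have hmid : (M.reflect.left s + M.reflect.right s) / 2 = -((M.left s + M.right s) / 2) := by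
    simp only [MonotoneArcs.reflect]
    ring
  rw [upperLabel, upperLabel, ← hζ.potential_reflect, hmid]
  simp only [MonotoneArcs.reflect, neg_neg]

theorem IsFlow.jump (hζ : M.IsFlow ζ) (g : W → B) :
    M.IsFlow fun s => g (M.upperLabel ζ s) - g (M.upperLabel ζ s + ζ s) := by
  classical
  intro v
  have right_sum := hζ.reflect.sum_leftEnd_eq g (-v.1, v.2)
  simp only [leftEnd_reflect_eq_iff, neg_neg, hζ.upperLabel_reflect, hζ.potential_reflect]
    at right_sum
  rw [hζ.sum_leftEnd_eq, right_sum, hζ v]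

end MonotoneArcs

section Circulation

variable {S X Y W : Type*} [Fintype S] [AddCommGroup W]

open scoped Classical in
/-- A circulation modulo two on a multigraph whose edge `s` joins the two members of `ends s`: the
values around every vertex sum to zero. It is meant for groups `W` of exponent two, where edges need
no direction. -/
def IsCirculation (ends : S → Sym2 X) (ζ : S → W) : Prop :=
  ∀ v, ∑ s with v ∈ ends s, ζ s = 0

/-- `A s` and `A s + ζ s` are the labels of the faces on the two sides of the edge `s`, in the sense
that the boundary of the union of any set of faces, or equivalently, of any function `g` of the
labels, is a circulation. -/
def IsFaceLabelling (ends : S → Sym2 X) (ζ A : S → W) : Prop :=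
  ∀ g : W → ZMod 2, IsCirculation ends fun s => g (A s) + g (A s + ζ s)

theorem isCirculation_iff [DecidableEq X] {ends : S → Sym2 X} {ζ : S → W} :
    IsCirculation ends ζ ↔ ∀ v, ∑ s with v ∈ ends s, ζ s = 0 := by
  unfold IsCirculation
  congr!

theorem isCirculation_map_iff {ends : S → Sym2 X} {f : X → Y} (hf : f.Injective) {ζ : S → W} :
    IsCirculation (fun s => (ends s).map f) ζ ↔ IsCirculation ends ζ := by
  classical
  have sum_eq (x : X) : ∑ s with f x ∈ (ends s).map f, ζ s = ∑ s with x ∈ ends s, ζ s := by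
    refine sum_congr (filter_congr fun s _ => ?_) fun _ _ => rfl
    rw [Sym2.mem_map]
    exact ⟨fun ⟨y, hy, h⟩ => hf h ▸ hy, fun h => ⟨x, h, rfl⟩⟩
  refine ⟨fun h x => (sum_eq x).symm.trans (h (f x)), fun h y => ?_⟩
  by_cases hy : ∃ x, f x = y
  · obtain ⟨x, rfl⟩ := hy
    exact (sum_eq x).trans (h x)
  · refine sum_eq_zero fun s hs => absurd ?_ hy
    obtain ⟨x, -, hx⟩ := Sym2.mem_map.1 (mem_filter.1 hs).2
    exact ⟨x, hx⟩

theorem isFaceLabelling_map_iff {ends : S → Sym2 X} {f : X → Y} (hf : f.Injective) {ζ A : S → W} :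
    IsFaceLabelling (fun s => (ends s).map f) ζ A ↔ IsFaceLabelling ends ζ A :=
  forall_congr' fun _ => isCirculation_map_iff hf

end Circulation

namespace MonotoneArcs

variable {S W : Type*} [Fintype S] [AddCommGroup W] [Module (ZMod 2) W]

theorem isCirculation_iff_isFlow (M : MonotoneArcs S) {ζ : S → W} :
    IsCirculation (fun s => s(M.leftEnd s, M.rightEnd s)) ζ ↔ M.IsFlow ζ := by
  classical
  rw [isCirculation_iff]
  refine forall_congr' fun v => ?_
  have hdisj : Disjoint (univ.filter fun s => M.leftEnd s = v)
      (univ.filter fun s => M.rightEnd s = v) := by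
    rw [disjoint_filter]
    exact fun s _ hl hr => (M.left_lt_right s).ne (congrArg Prod.fst (hl.trans hr.symm))
  rw [← sub_eq_zero (a := ∑ s with M.leftEnd s = v, ζ s), ZModModule.sub_eq_add,
    ← sum_union hdisj, ← filter_or]
  exact Eq.congr_left (sum_congr (filter_congr fun s _ => by simp [eq_comm]) fun _ _ => rfl)

theorem isFaceLabelling_upperLabel (M : MonotoneArcs S) {ζ : S → W}
    (hζ : IsCirculation (fun s => s(M.leftEnd s, M.rightEnd s)) ζ) :
    IsFaceLabelling (fun s => s(M.leftEnd s, M.rightEnd s)) ζ (M.upperLabel ζ) := by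
  intro g
  simpa only [ZModModule.sub_eq_add] using
    M.isCirculation_iff_isFlow.2 ((M.isCirculation_iff_isFlow.1 hζ).jump g)

end MonotoneArcs

section Segments

variable {S W : Type*} [AddCommGroup W] [Module (ZMod 2) W] {P Q : S → Plane}

theorem mk_mem_openSegment {p q : Plane} {x : ℝ} (hx : x ∈ Set.Ioo p.1 q.1) :
    (x, p.2 + (x - p.1) / (q.1 - p.1) * (q.2 - p.2)) ∈ openSegment ℝ p q := by
  have hpq : 0 < q.1 - p.1 := sub_pos.2 (hx.1.trans hx.2)
  rw [openSegment_eq_image']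
  refine ⟨(x - p.1) / (q.1 - p.1), ⟨div_pos (sub_pos.2 hx.1) hpq,
    (div_lt_one hpq).2 (sub_lt_sub_right hx.2 _)⟩, ?_⟩
  ext
  · simp [hpq.ne']
  · simp

theorem mk_mem_segment {p q : Plane} {x : ℝ} (hpq : p.1 < q.1) (hx : x ∈ Set.Icc p.1 q.1) :
    (x, p.2 + (x - p.1) / (q.1 - p.1) * (q.2 - p.2)) ∈ segment ℝ p q := by
  rcases hx.1.eq_or_lt with rfl | hpx
  · simpa using left_mem_segment ℝ p q
  rcases hx.2.eq_or_lt with rfl | hxq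
  · simpa [(sub_pos.2 hpq).ne'] using right_mem_segment ℝ p q
  · exact openSegment_subset_segment ℝ p q (mk_mem_openSegment ⟨hpx, hxq⟩)

/-- Straight line segments from `P s` to `Q s` as monotone arcs. -/
noncomputable def MonotoneArcs.ofSegments (P Q : S → Plane) (hlt : ∀ s, (P s).1 < (Q s).1)
    (hdisj : ∀ s t, s ≠ t → Disjoint (openSegment ℝ (P s) (Q s)) (segment ℝ (P t) (Q t))) :
    MonotoneArcs S where
  left s := (P s).1
  right s := (Q s).1
  height s x := (P s).2 + (x - (P s).1) / ((Q s).1 - (P s).1) * ((Q s).2 - (P s).2)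
  left_lt_right := hlt
  continuousOn_height s := by fun_prop
  height_ne s t hst x hx hx' heq := Set.disjoint_left.1 (hdisj s t hst) (mk_mem_openSegment hx)
    (heq ▸ mk_mem_segment (hlt t) hx')

/-- The linear map `(x, y) ↦ (x + c * y, y)`. -/
def shear (c : ℝ) : Plane ≃ₗ[ℝ] Plane where
  toFun p := (p.1 + c * p.2, p.2)
  invFun p := (p.1 - c * p.2, p.2)
  map_add' p q := by ext <;> simp; ring
  map_smul' r p := by ext <;> simp; ring
  left_inv p := by simp
  right_inv p := by simp

theorem exists_shear_fst_ne [Finite S] (hne : ∀ s, P s ≠ Q s) :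
    ∃ c, ∀ s, (shear c (P s)).1 ≠ (shear c (Q s)).1 := by
  obtain ⟨c, hc⟩ := (Set.finite_range fun s =>
    ((P s).1 - (Q s).1) / ((Q s).2 - (P s).2)).exists_notMem
  refine ⟨c, fun s heq => ?_⟩
  simp only [shear, LinearEquiv.coe_mk, LinearMap.coe_mk, AddHom.coe_mk] at heq
  by_cases h2 : (P s).2 = (Q s).2
  · exact hne s (Prod.ext (by simpa [h2] using heq) h2)
  · refine hc ⟨s, (div_eq_iff (sub_ne_zero.2 (Ne.symm h2))).2 ?_⟩
    linarith

theorem exists_isFaceLabelling_of_fst_ne [Fintype S] (hne : ∀ s, (P s).1 ≠ (Q s).1)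
    (hdisj : ∀ s t, s ≠ t → Disjoint (openSegment ℝ (P s) (Q s)) (segment ℝ (P t) (Q t)))
    {ζ : S → W} (hζ : IsCirculation (fun s => s(P s, Q s)) ζ) :
    ∃ A, IsFaceLabelling (fun s => s(P s, Q s)) ζ A := by
  have oriented (s : S) : ∃ p q : Plane, p.1 < q.1 ∧ s(p, q) = s(P s, Q s) ∧
      openSegment ℝ p q = openSegment ℝ (P s) (Q s) ∧ segment ℝ p q = segment ℝ (P s) (Q s) := by
    rcases (hne s).lt_or_gt with h | h
    · exact ⟨P s, Q s, h, rfl, rfl, rfl⟩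
    · exact ⟨Q s, P s, h, Sym2.eq_swap, openSegment_symm _ _ _, segment_symm _ _ _⟩
  choose p q hlt hends hopen hclosed using oriented
  let M := MonotoneArcs.ofSegments p q hlt fun s t hst => by
    rw [hopen, hclosed]
    exact hdisj s t hst
  have ends_eq : (fun s => s(M.leftEnd s, M.rightEnd s)) = fun s => s(P s, Q s) := by
    funext s
    rw [← hends]
    have : (q s).1 - (p s).1 ≠ 0 := (sub_pos.2 (hlt s)).ne'
    simp [MonotoneArcs.leftEnd, MonotoneArcs.rightEnd, M, MonotoneArcs.ofSegments, this]
  rw [← ends_eq] at hζ ⊢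
  exact ⟨_, M.isFaceLabelling_upperLabel hζ⟩

theorem exists_isFaceLabelling_of_segments [Fintype S] (hne : ∀ s, P s ≠ Q s)
    (hdisj : ∀ s t, s ≠ t → Disjoint (openSegment ℝ (P s) (Q s)) (segment ℝ (P t) (Q t)))
    {ζ : S → W} (hζ : IsCirculation (fun s => s(P s, Q s)) ζ) :
    ∃ A, IsFaceLabelling (fun s => s(P s, Q s)) ζ A := by
  obtain ⟨c, hc⟩ := exists_shear_fst_ne hne
  have hinj : Function.Injective (shear c) := (shear c).injective
  obtain ⟨A, hA⟩ := exists_isFaceLabelling_of_fst_ne (ζ := ζ) hc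
    (fun s t hst => by
      have hopen := image_openSegment ℝ (shear c).toLinearMap.toAffineMap (P s) (Q s)
      have hclosed := image_segment ℝ (shear c).toLinearMap.toAffineMap (P t) (Q t)
      simp only [LinearMap.coe_toAffineMap, LinearEquiv.coe_coe] at hopen hclosed
      rw [← hopen, ← hclosed, Set.disjoint_image_iff hinj]
      exact hdisj s t hst)
    ((isCirculation_map_iff hinj).2 hζ)
  exact ⟨A, (isFaceLabelling_map_iff hinj).1 hA⟩

end Segments

namespace PolygonalArc

variable (A : PolygonalArc)

/-- The unordered pair of ends of a segment of a polygonal arc. -/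
def segmentEnds (i : Fin A.n) : Sym2 Plane := s(A.pt i.castSucc, A.pt i.succ)

theorem pt_mem_segmentEnds_iff {k : Fin (A.n + 1)} {i : Fin A.n} :
    A.pt k ∈ A.segmentEnds i ↔ k = i.castSucc ∨ k = i.succ := by
  rw [segmentEnds, Sym2.mem_iff, A.pt_injective.eq_iff, A.pt_injective.eq_iff]

theorem pt_mem_ends_iff {k : Fin (A.n + 1)} : A.pt k ∈ A.ends ↔ k = 0 ∨ k = Fin.last A.n := by
  rw [ends, Sym2.mem_iff, A.pt_injective.eq_iff, A.pt_injective.eq_iff]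

theorem exists_pt_mem_segmentEnds (k : Fin (A.n + 1)) : ∃ i, A.pt k ∈ A.segmentEnds i := by
  simp only [pt_mem_segmentEnds_iff]
  rcases Fin.eq_castSucc_or_eq_last k with ⟨i, rfl⟩ | rfl
  · exact ⟨i, Or.inl rfl⟩
  · obtain ⟨m, hm⟩ := Nat.exists_eq_succ_of_ne_zero A.n_pos.ne'
    exact ⟨⟨m, by lia⟩, Or.inr (by ext; simp [hm])⟩

theorem mem_segment_of_mem_segmentEnds {i : Fin A.n} {x : Plane} (hx : x ∈ A.segmentEnds i) :
    x ∈ segment ℝ (A.pt i.castSucc) (A.pt i.succ) := by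
  rcases Sym2.mem_iff.1 hx with rfl | rfl
  · exact left_mem_segment ℝ _ _
  · exact right_mem_segment ℝ _ _

theorem pt_mem_carrier (k : Fin (A.n + 1)) : A.pt k ∈ A.carrier := by
  obtain ⟨i, hi⟩ := A.exists_pt_mem_segmentEnds k
  exact Set.mem_iUnion.2 ⟨i, A.mem_segment_of_mem_segmentEnds hi⟩

theorem notMem_openSegment_of_mem_segmentEnds {i : Fin A.n} {x : Plane}
    (hx : x ∈ A.segmentEnds i) : x ∉ openSegment ℝ (A.pt i.castSucc) (A.pt i.succ) := by
  have hne : A.pt i.castSucc ≠ A.pt i.succ := A.pt_injective.ne i.castSucc_lt_succ.ne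
  rcases Sym2.mem_iff.1 hx with rfl | rfl
  · exact mt left_mem_openSegment_iff.1 hne
  · exact mt right_mem_openSegment_iff.1 hne

theorem disjoint_openSegment_segment {i j : Fin A.n} (hij : i ≠ j) :
    Disjoint (openSegment ℝ (A.pt i.castSucc) (A.pt i.succ))
      (segment ℝ (A.pt j.castSucc) (A.pt j.succ)) := by
  rw [Set.disjoint_left]
  intro x hx hxj
  have hxi := openSegment_subset_segment ℝ _ _ hx
  refine A.notMem_openSegment_of_mem_segmentEnds (Sym2.mem_iff.2 ?_) hx
  rcases hij.lt_or_gt with h | h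
  · exact Or.inr (A.simple i j h x hxi hxj).1
  · exact Or.inl (A.simple j i h x hxj hxi).2

theorem pt_notMem_openSegment (k : Fin (A.n + 1)) (i : Fin A.n) :
    A.pt k ∉ openSegment ℝ (A.pt i.castSucc) (A.pt i.succ) := by
  obtain ⟨j, hj⟩ := A.exists_pt_mem_segmentEnds k
  rcases eq_or_ne i j with rfl | hij
  · exact A.notMem_openSegment_of_mem_segmentEnds hj
  · exact Set.disjoint_right.1 (A.disjoint_openSegment_segment hij)
      (A.mem_segment_of_mem_segmentEnds hj)

theorem ne_of_mem_ends_of_mem_openSegment {x y : Plane} {i : Fin A.n} (hx : x ∈ A.ends)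
    (hy : y ∈ openSegment ℝ (A.pt i.castSucc) (A.pt i.succ)) : x ≠ y := by
  rintro rfl
  rcases Sym2.mem_iff.1 hx with rfl | rfl <;> exact A.pt_notMem_openSegment _ i hy

variable {W : Type*} [AddCommGroup W]

open scoped Classical in
theorem sum_mem_segmentEnds (f : Fin A.n → W) (v : Plane) :
    ∑ i with v ∈ A.segmentEnds i, f i =
      ∑ i, (if v = A.pt i.castSucc then f i else 0) +
        ∑ i, (if v = A.pt i.succ then f i else 0) := by
  rw [sum_filter, ← sum_add_distrib]
  refine sum_congr rfl fun i _ => ?_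
  have hne : A.pt i.castSucc ≠ A.pt i.succ := A.pt_injective.ne i.castSucc_lt_succ.ne
  by_cases h : v = A.pt i.castSucc
  · simp [segmentEnds, h, hne]
  · simp [segmentEnds, h]

variable [Module (ZMod 2) W]

open scoped Classical in
theorem sum_mem_segmentEnds_const (x : W) (v : Plane) :
    ∑ i with v ∈ A.segmentEnds i, x = if v ∈ A.ends then x else 0 := by
  let f (k : Fin (A.n + 1)) : W := if v = A.pt k then x else 0
  have hne : A.pt 0 ≠ A.pt (Fin.last A.n) := by
    have := A.n_pos
    exact A.pt_injective.ne (Fin.ext_iff.not.2 (by simp; lia))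
  calc ∑ i with v ∈ A.segmentEnds i, x
      = ∑ i : Fin A.n, f i.castSucc + ∑ i : Fin A.n, f i.succ := A.sum_mem_segmentEnds _ v
    _ = f 0 + f (Fin.last A.n) := by
      rw [eq_sub_of_add_eq (Fin.sum_univ_castSucc f).symm,
        eq_sub_of_add_eq' (Fin.sum_univ_succ f).symm]
      simp only [ZModModule.sub_eq_add]
      rw [add_add_add_comm, ZModModule.add_self, zero_add, add_comm]
    _ = if v ∈ A.ends then x else 0 := by
      by_cases h : v = A.pt 0
      · simp [f, ends, h, hne]
      · simp [f, ends, h]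

open scoped Classical in
theorem eq_of_sum_mem_segmentEnds_eq_zero {f : Fin A.n → W}
    (hf : ∀ k, A.pt k ∉ A.ends → ∑ i with A.pt k ∈ A.segmentEnds i, f i = 0) (i : Fin A.n) :
    f i = f ⟨0, A.n_pos⟩ := by
  obtain ⟨i, hi⟩ := i
  induction i with
  | zero => rfl
  | succ i ih =>
    have hi' : i < A.n := by lia
    rw [← ih hi']
    have hv := hf (Fin.succ ⟨i, hi'⟩) (by
      rw [pt_mem_ends_iff]
      simp [Fin.ext_iff]
      lia)
    rw [sum_mem_segmentEnds] at hv
    have castSucc_iff (j : Fin A.n) : Fin.succ ⟨i, hi'⟩ = j.castSucc ↔ ⟨i + 1, hi⟩ = j := by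
      simp [Fin.ext_iff]
    simp only [A.pt_injective.eq_iff, Fin.succ_inj, castSucc_iff, sum_ite_eq, mem_univ,
      if_true] at hv
    rwa [← ZModModule.sub_eq_add, sub_eq_zero] at hv

end PolygonalArc

section Arcs

variable {E W : Type*} [AddCommGroup W] [Module (ZMod 2) W] {arc : E → PolygonalArc}

theorem isCirculation_segmentEnds_iff [Fintype E] {ζ : E → W} :
    IsCirculation (fun s : Σ e, Fin (arc e).n => (arc s.1).segmentEnds s.2) (fun s => ζ s.1) ↔
      IsCirculation (fun e => (arc e).ends) ζ := by
  classical
  rw [isCirculation_iff, isCirculation_iff]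
  refine forall_congr' fun v => ?_
  rw [sum_filter, sum_filter, Fintype.sum_sigma]
  refine Eq.congr_left (sum_congr rfl fun e _ => ?_)
  rw [← sum_filter]
  exact (arc e).sum_mem_segmentEnds_const (ζ e) v

theorem eq_of_isCirculation_segmentEnds [Fintype E] {f : (Σ e, Fin (arc e).n) → W}
    (hinter : ∀ e f, e ≠ f → ∀ x ∈ (arc e).carrier, x ∈ (arc f).carrier → x ∈ (arc e).ends)
    (hf : IsCirculation (fun s : Σ e, Fin (arc e).n => (arc s.1).segmentEnds s.2) f)
    (s : Σ e, Fin (arc e).n) : f s = f ⟨s.1, 0, (arc s.1).n_pos⟩ := by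
  classical
  obtain ⟨e, i⟩ := s
  refine (arc e).eq_of_sum_mem_segmentEnds_eq_zero (f := fun i => f ⟨e, i⟩) (fun k hk => ?_) i
  have hsum := isCirculation_iff.1 hf ((arc e).pt k)
  rw [sum_filter, Fintype.sum_sigma, sum_eq_single_of_mem e (mem_univ e)] at hsum
  · simpa only [sum_filter] using hsum
  · refine fun e' _ hne => sum_eq_zero fun i' _ => if_neg fun h => hk ?_
    exact hinter e e' hne.symm _ ((arc e).pt_mem_carrier k)
      (Set.mem_iUnion.2 ⟨i', (arc e').mem_segment_of_mem_segmentEnds h⟩)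

theorem disjoint_openSegment_segment_of_inter
    (hinter : ∀ e f, e ≠ f → ∀ x ∈ (arc e).carrier, x ∈ (arc f).carrier → x ∈ (arc e).ends)
    {s t : Σ e, Fin (arc e).n} (hst : s ≠ t) :
    Disjoint (openSegment ℝ ((arc s.1).pt s.2.castSucc) ((arc s.1).pt s.2.succ))
      (segment ℝ ((arc t.1).pt t.2.castSucc) ((arc t.1).pt t.2.succ)) := by
  obtain ⟨e, i⟩ := s
  obtain ⟨f, j⟩ := t
  rcases eq_or_ne e f with rfl | hef
  · exact (arc e).disjoint_openSegment_segment fun h => hst (Sigma.ext rfl (heq_of_eq h))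
  · refine Set.disjoint_left.2 fun x hx hx' => ?_
    refine (arc e).ne_of_mem_ends_of_mem_openSegment (hinter e f hef x ?_ ?_) hx rfl
    · exact Set.mem_iUnion.2 ⟨i, openSegment_subset_segment ℝ _ _ hx⟩
    · exact Set.mem_iUnion.2 ⟨j, hx'⟩

theorem exists_isFaceLabelling_of_arcs [Fintype E]
    (hinter : ∀ e f, e ≠ f → ∀ x ∈ (arc e).carrier, x ∈ (arc f).carrier → x ∈ (arc e).ends)
    {ζ : E → W} (hζ : IsCirculation (fun e => (arc e).ends) ζ) :
    ∃ A, IsFaceLabelling (fun e => (arc e).ends) ζ A := by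
  obtain ⟨A, hA⟩ := exists_isFaceLabelling_of_segments
    (fun s : Σ e, Fin (arc e).n => (arc s.1).pt_injective.ne s.2.castSucc_lt_succ.ne)
    (fun _ _ => disjoint_openSegment_segment_of_inter hinter)
    (isCirculation_segmentEnds_iff.2 hζ)
  refine ⟨fun e => A ⟨e, 0, (arc e).n_pos⟩, fun g => isCirculation_segmentEnds_iff.1 ?_⟩
  exact (funext (eq_of_isCirculation_segmentEnds hinter (hA g))) ▸ hA g

theorem PlaneDrawing.exists_isFaceLabelling {V : Type*} {G : SimpleGraph V} [Fintype G.edgeSet]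
    (D : PlaneDrawing G) {ζ : G.edgeSet → W}
    (hζ : IsCirculation (fun e : G.edgeSet => (e : Sym2 V)) ζ) :
    ∃ A, IsFaceLabelling (fun e : G.edgeSet => (e : Sym2 V)) ζ A := by
  rw [← isCirculation_map_iff D.point_injective] at hζ
  simp only [← isFaceLabelling_map_iff D.point_injective, ← D.arc_ends] at hζ ⊢
  refine exists_isFaceLabelling_of_arcs (fun e f hef x hxe hxf => ?_) hζ
  obtain ⟨v, hve, -, rfl⟩ := D.arc_inter e f hef x hxe hxf
  exact D.arc_ends e ▸ Sym2.mem_map.2 ⟨v, hve, rfl⟩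

end Arcs

section CutSpace

variable {V : Type*}

/-- The coboundary modulo two of a function on vertices: the sum of its values at the two ends of an
edge. The coboundary of the indicator function of `S` indicates the edges that leave `S`. -/
def coboundary : (V → ZMod 2) →ₗ[ZMod 2] Sym2 V → ZMod 2 where
  toFun c := Sym2.lift ⟨fun a b => c a + c b, fun _ _ => add_comm _ _⟩
  map_add' c d := by
    ext ⟨a, b⟩
    exact add_add_add_comm _ _ _ _
  map_smul' r c := by
    ext ⟨a, b⟩
    exact (mul_add r _ _).symm

theorem coboundary_mk (c : V → ZMod 2) (a b : V) : coboundary c s(a, b) = c a + c b := rfl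

theorem coboundary_mk_eq_zero_iff {c : V → ZMod 2} {a b : V} :
    coboundary c s(a, b) = 0 ↔ c a = c b := by
  rw [coboundary_mk, ← ZModModule.sub_eq_add, sub_eq_zero]

open scoped Classical in
theorem coboundary_single_one (u : V) {e : Sym2 V} (he : ¬ e.IsDiag) :
    coboundary (Pi.single u 1) e = if u ∈ e then 1 else 0 := by
  induction e with
  | _ a b =>
    rw [Sym2.mk_isDiag_iff] at he
    simp only [coboundary_mk, Pi.single_apply, Sym2.mem_iff]
    grind

theorem eq_of_reachable {G : SimpleGraph V} {c : V → ZMod 2}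
    (hc : ∀ e ∈ G.edgeSet, coboundary c e = 0) {u v : V} (huv : G.Reachable u v) : c u = c v := by
  obtain ⟨p⟩ := huv
  induction p with
  | nil => rfl
  | cons h _ ih => exact (coboundary_mk_eq_zero_iff.1 (hc _ h)).trans ih

theorem coboundary_eq_zero_of_isEdgeConnected {G : SimpleGraph V} {k : ℕ} (hG : G.IsEdgeConnected k)
    {c : V → ZMod 2} (hc : {e ∈ G.edgeSet | coboundary c e ≠ 0}.encard < k) : coboundary c = 0 := by
  ext ⟨u, v⟩
  refine coboundary_mk_eq_zero_iff.2 (eq_of_reachable (fun e he => ?_) (hG u v hc))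
  rw [SimpleGraph.edgeSet_deleteEdges] at he
  exact of_not_not fun h => he.2 ⟨he.1, h⟩

variable (G : SimpleGraph V)

/-- The cut space of a graph modulo two, spanned by the indicator functions of its edge cuts. -/
def cutSpace : Submodule (ZMod 2) (G.edgeSet → ZMod 2) :=
  LinearMap.range (LinearMap.funLeft (ZMod 2) (ZMod 2) ((↑) : G.edgeSet → Sym2 V) ∘ₗ coboundary)

theorem finrank_cutSpace_lt [Fintype V] [Nonempty V] :
    Module.finrank (ZMod 2) (cutSpace G) < Fintype.card V := by
  set δ := LinearMap.funLeft (ZMod 2) (ZMod 2) ((↑) : G.edgeSet → Sym2 V) ∘ₗ coboundary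
  have one_mem : (1 : V → ZMod 2) ∈ LinearMap.ker δ := by
    ext ⟨⟨a, b⟩, _⟩
    exact CharTwo.add_self_eq_zero 1
  have ker_pos : 0 < Module.finrank (ZMod 2) (LinearMap.ker δ) :=
    Submodule.one_le_finrank_iff.2 (Submodule.ne_bot_iff _ |>.2 ⟨1, one_mem, one_ne_zero⟩)
  have rank_nullity := δ.finrank_range_add_finrank_ker
  rw [Module.finrank_fintype_fun_eq_card] at rank_nullity
  exact lt_of_lt_of_eq (lt_add_of_pos_right _ ker_pos) rank_nullity

variable {G} in
theorem eq_zero_of_mem_cutSpace {k : ℕ} (hG : G.IsEdgeConnected k) {x : G.edgeSet → ZMod 2}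
    (hx : x ∈ cutSpace G) {T : Set (Sym2 V)} (hT : T.encard < k) (hxT : ∀ e, x e ≠ 0 → ↑e ∈ T) :
    x = 0 := by
  obtain ⟨c, rfl⟩ := hx
  have hc : coboundary c = 0 := coboundary_eq_zero_of_isEdgeConnected hG
    ((Set.encard_le_encard fun e he => hxT ⟨e, he.1⟩ he.2).trans_lt hT)
  rw [LinearMap.comp_apply, hc, map_zero]

open scoped Classical in
/-- The class of an edge modulo the cut space. For a plane graph, these classes play the role of the
edges of the dual graph: the sum along a closed walk in the dual is zero. -/
noncomputable def edgeClass (e : G.edgeSet) : (G.edgeSet → ZMod 2) ⧸ cutSpace G :=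
  (cutSpace G).mkQ (Pi.single e 1)

variable {G} in
theorem edgeClass_ne_zero (hG : G.IsEdgeConnected 2) (e : G.edgeSet) : edgeClass G e ≠ 0 := by
  classical
  intro h
  rw [edgeClass, Submodule.mkQ_apply, Submodule.Quotient.mk_eq_zero] at h
  have single_eq_zero := eq_zero_of_mem_cutSpace hG h (T := {(e : Sym2 V)}) (by simp) fun f hf => by
    by_contra hfe
    exact hf (Pi.single_eq_of_ne (fun h => hfe (congrArg Subtype.val h)) _)
  simpa using congrFun single_eq_zero e

variable {G} in
theorem edgeClass_injective (hG : G.IsEdgeConnected 3) : Function.Injective (edgeClass G) := by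
  classical
  intro e f h
  by_contra hef
  rw [edgeClass, edgeClass, ← sub_eq_zero, ← map_sub, Submodule.mkQ_apply,
    Submodule.Quotient.mk_eq_zero] at h
  have hcard : ({(e : Sym2 V), (f : Sym2 V)} : Set (Sym2 V)).encard < (3 : ℕ) :=
    (Set.encard_pair (Subtype.coe_injective.ne hef)).trans_lt (by norm_num)
  have sub_eq_zero := eq_zero_of_mem_cutSpace hG h hcard fun x hx => by
    by_contra hxef
    refine hx ?_
    rw [Pi.sub_apply, Pi.single_eq_of_ne, Pi.single_eq_of_ne, sub_zero]
    · rintro rfl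
      simp at hxef
    · rintro rfl
      simp at hxef
  simpa [hef] using congrFun sub_eq_zero e

theorem isCirculation_edgeClass [Fintype G.edgeSet] :
    IsCirculation (fun e : G.edgeSet => (e : Sym2 V)) (edgeClass G) := by
  classical
  rw [isCirculation_iff]
  intro u
  simp only [edgeClass]
  rw [← map_sum, Submodule.mkQ_apply, Submodule.Quotient.mk_eq_zero]
  refine ⟨Pi.single u 1, ?_⟩
  ext e
  have := coboundary_single_one u (G.not_isDiag_of_mem_edgeSet e.2)
  simp [LinearMap.funLeft_apply, Finset.sum_apply, Pi.single_apply, this]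

theorem span_range_edgeClass [Finite G.edgeSet] :
    Submodule.span (ZMod 2) (Set.range (edgeClass G)) = ⊤ := by
  classical
  have range_eq : Set.range (edgeClass G) =
      (cutSpace G).mkQ '' Set.range (Pi.basisFun (ZMod 2) G.edgeSet) := by
    rw [← Set.range_comp]
    congr 1
    ext e
    simp [edgeClass]
  rw [range_eq, Submodule.span_image, Module.Basis.span_eq, Submodule.map_top, Submodule.range_mkQ]

end CutSpace

section EvenEdgeSets

variable {V : Type*} {G : SimpleGraph V} {K L : Finset (Sym2 V)}

open scoped Classical in
/-- A set of edges is even if every vertex lies on an even number of its members. -/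
def IsEven (K : Finset (Sym2 V)) : Prop :=
  ∀ u, Even #{e ∈ K | u ∈ e}

theorem IsEven.sdiff [DecidableEq (Sym2 V)] (hK : IsEven K) (hL : IsEven L) (hLK : L ⊆ K) :
    IsEven (K \ L) := by
  classical
  intro u
  have degree_add : #{e ∈ K \ L | u ∈ e} + #{e ∈ L | u ∈ e} = #{e ∈ K | u ∈ e} := by
    rw [← card_union_of_disjoint (disjoint_filter_filter sdiff_disjoint), ← filter_union,
      sdiff_union_of_subset hLK]
  exact (Nat.even_add.1 (degree_add ▸ hK u)).2 (hL u)

theorem isEven_edges_toFinset [DecidableEq (Sym2 V)] {u : V} {w : G.Walk u u} (hw : w.IsTrail) :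
    IsEven w.edges.toFinset := by
  classical
  intro x
  have even_count := (hw.even_countP_edges_iff x).2 fun h => absurd rfl h
  rw [List.countP_eq_length_filter, ← List.toFinset_card_of_nodup (hw.edges_nodup.filter _),
    List.toFinset_filter] at even_count
  simpa only [decide_eq_true_eq] using even_count

theorem IsEven.sum_coboundary [Finite V] (hK : IsEven K) (hdiag : ∀ e ∈ K, ¬ e.IsDiag)
    (c : V → ZMod 2) : ∑ e ∈ K, coboundary c e = 0 := by
  classical
  let φ : (V → ZMod 2) →ₗ[ZMod 2] ZMod 2 := ∑ e ∈ K, LinearMap.proj e ∘ₗ coboundary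
  have φ_eq_zero : φ = 0 := by
    refine LinearMap.pi_ext' fun u => LinearMap.ext_ring ?_
    calc φ (Pi.single u 1) = ∑ e ∈ K, coboundary (Pi.single u 1) e := by simp [φ]
      _ = ∑ e ∈ K, if u ∈ e then 1 else 0 :=
        sum_congr rfl fun e he => coboundary_single_one u (hdiag e he)
      _ = (#{e ∈ K | u ∈ e} : ZMod 2) := sum_boole _ _
      _ = 0 := (ZMod.natCast_eq_zero_iff_even).2 (hK u)
  simpa [φ] using LinearMap.congr_fun φ_eq_zero c

theorem IsEven.not_isBridge [Finite V] (hK : IsEven K) (hdiag : ∀ e ∈ K, ¬ e.IsDiag) {e : Sym2 V}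
    (he : e ∈ K) : ¬ (SimpleGraph.fromEdgeSet (K : Set (Sym2 V))).IsBridge e := by
  classical
  induction e with
  | _ a b =>
    set H := (SimpleGraph.fromEdgeSet (K : Set (Sym2 V)))
    intro hbridge
    let c (x : V) : ZMod 2 := if (H.deleteEdges {s(a, b)}).Reachable a x then 1 else 0
    have coboundary_eq_zero : ∀ f ∈ K, f ≠ s(a, b) → coboundary c f = 0 := by
      rintro ⟨x, y⟩ hf hne
      have hxy : (H.deleteEdges {s(a, b)}).Adj x y := by
        rw [SimpleGraph.deleteEdges_adj, SimpleGraph.fromEdgeSet_adj]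
        exact ⟨⟨hf, Sym2.mk_isDiag_iff.not.1 (hdiag _ hf)⟩, hne⟩
      refine coboundary_mk_eq_zero_iff.2 (if_congr ?_ rfl rfl)
      exact ⟨fun h => h.trans hxy.reachable, fun h => h.trans hxy.symm.reachable⟩
    have hsum := hK.sum_coboundary hdiag c
    rw [sum_eq_single_of_mem _ he coboundary_eq_zero, coboundary_mk_eq_zero_iff] at hsum
    simp only [c, SimpleGraph.Reachable.refl, if_true,
      if_neg (SimpleGraph.isBridge_iff.1 hbridge)] at hsum
    exact one_ne_zero hsum

theorem IsEven.exists_isCycle [Finite V] (hK : IsEven K) (hsub : (K : Set (Sym2 V)) ⊆ G.edgeSet)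
    (hne : K.Nonempty) : ∃ (u : V) (w : G.Walk u u), w.IsCycle ∧ ∀ e ∈ w.edges, e ∈ K := by
  set H := (SimpleGraph.fromEdgeSet (K : Set (Sym2 V)))
  have hdiag : ∀ e ∈ K, ¬ e.IsDiag := fun e he => G.not_isDiag_of_mem_edgeSet (hsub he)
  have edgeSet_eq : H.edgeSet = K := by
    ext e
    rw [SimpleGraph.edgeSet_fromEdgeSet, Set.mem_sdiff]
    exact and_iff_left_of_imp (hdiag e)
  have hHG : H ≤ G := by
    rw [← SimpleGraph.edgeSet_subset_edgeSet, edgeSet_eq]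
    exact hsub
  have hcyclic : ¬ H.IsAcyclic := by
    rw [SimpleGraph.isAcyclic_iff_forall_isBridge]
    intro h
    obtain ⟨e, he⟩ := hne
    exact hK.not_isBridge hdiag he (h (edgeSet_eq ▸ he))
  rw [SimpleGraph.IsAcyclic] at hcyclic
  push Not at hcyclic
  obtain ⟨u, w, hw⟩ := hcyclic
  refine ⟨u, w.mapLe hHG, hw.mapLe hHG, fun e he => ?_⟩
  rw [SimpleGraph.Walk.edges_mapLe_eq_edges] at he
  have := w.edges_subset_edgeSet he
  rwa [edgeSet_eq] at this

theorem IsEven.three_le_card [Finite V] (hK : IsEven K) (hsub : (K : Set (Sym2 V)) ⊆ G.edgeSet)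
    (hne : K.Nonempty) : 3 ≤ #K := by
  classical
  obtain ⟨u, w, hw, hwK⟩ := hK.exists_isCycle hsub hne
  calc 3 ≤ w.length := hw.three_le_length
    _ = #w.edges.toFinset := by
      rw [List.toFinset_card_of_nodup hw.edges_nodup, SimpleGraph.Walk.length_edges]
    _ ≤ #K := card_le_card fun e he => hwK e (List.mem_toFinset.1 he)

theorem IsEven.exists_isCycleOfLength [Finite V] (hK : IsEven K)
    (hsub : (K : Set (Sym2 V)) ⊆ G.edgeSet) (hne : K.Nonempty) (hcard : #K < 6) :
    ∃ C : G.Subgraph, IsCycleOfLength #K C ∧ C.edgeSet = K := by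
  classical
  obtain ⟨u, w, hw, hwK⟩ := hK.exists_isCycle hsub hne
  have hwK' : w.edges.toFinset ⊆ K := fun e he => hwK e (List.mem_toFinset.1 he)
  have length_eq : w.length = #w.edges.toFinset := by
    rw [List.toFinset_card_of_nodup hw.edges_nodup, SimpleGraph.Walk.length_edges]
  have edges_eq : w.edges.toFinset = K := by
    by_contra hwne
    have rest := (hK.sdiff (isEven_edges_toFinset hw.isTrail) hwK').three_le_card (G := G)
      (fun e he => hsub (mem_sdiff.1 he).1) (sdiff_nonempty.2 fun h => hwne (hwK'.antisymm h))
    rw [card_sdiff_of_subset hwK', ← length_eq] at rest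
    have := hw.three_le_length
    lia
  refine ⟨w.toSubgraph, ⟨u, w, hw, by rw [length_eq, edges_eq], rfl⟩, ?_⟩
  ext e
  rw [SimpleGraph.Walk.mem_edges_toSubgraph, ← edges_eq, mem_coe, List.mem_toFinset]

open scoped Classical in
theorem sum_degree_eq_two_mul_card [Fintype V] (hdiag : ∀ e ∈ K, ¬ e.IsDiag) :
    ∑ u, #{e ∈ K | u ∈ e} = 2 * #K := by
  calc ∑ u, #{e ∈ K | u ∈ e} = ∑ e ∈ K, #{u | u ∈ e} :=
        sum_card_bipartiteAbove_eq_sum_card_bipartiteBelow (fun u e => u ∈ e)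
    _ = ∑ e ∈ K, 2 := by
      refine sum_congr rfl fun e he => ?_
      rw [← Sym2.card_toFinset_of_not_isDiag e (hdiag e he)]
      congr 1
      ext u
      simp
    _ = 2 * #K := by rw [sum_const, smul_eq_mul, mul_comm]

theorem IsEven.two_mul_card_le [Finite V] (hK : IsEven K) (hdiag : ∀ e ∈ K, ¬ e.IsDiag)
    (hLK : L ⊆ K) (hL : ∀ e ∈ L, ∀ f ∈ L, ∀ u, u ∈ e → u ∈ f → e = f) : 2 * #L ≤ #K := by
  classical
  cases nonempty_fintype V
  have degree_le (u : V) : 2 * #{e ∈ L | u ∈ e} ≤ #{e ∈ K | u ∈ e} := by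
    have degree_mono : #{e ∈ L | u ∈ e} ≤ #{e ∈ K | u ∈ e} :=
      card_le_card (filter_subset_filter _ hLK)
    have degree_le_one : #{e ∈ L | u ∈ e} ≤ 1 := by
      refine card_le_one.2 fun e he f hf => ?_
      rw [mem_filter] at he hf
      exact hL e he.1 f hf.1 u he.2 hf.2
    obtain ⟨k, hk⟩ := hK u
    lia
  have handshake := sum_le_sum fun u (_ : u ∈ univ) => degree_le u
  rw [← mul_sum, sum_degree_eq_two_mul_card hdiag,
    sum_degree_eq_two_mul_card fun e he => hdiag e (hLK he)] at handshake
  lia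

end EvenEdgeSets

/-- No two triangles have a common vertex. -/
def DisjointTriangles {V : Type*} (G : SimpleGraph V) : Prop :=
  ∀ T₁ T₂ : G.Subgraph, IsTriangle T₁ → IsTriangle T₂ → T₁ ≠ T₂ → ¬ Intersecting T₁ T₂

/-- Every triangle shares an edge with at most one cycle of length four. -/
def FewAdjacentFourCycles {V : Type*} (G : SimpleGraph V) : Prop :=
  ∀ T : G.Subgraph, IsTriangle T →
    {C : G.Subgraph | IsCycleOfLength 4 C ∧ Adjacent T C}.encard ≤ 1

/-- A combinatorial substitute for the faces of a plane graph: every face is given by the set of the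
edges on its boundary, and different faces share at most one edge. -/
structure FaceSystem {V : Type*} (G : SimpleGraph V) (F : Type*) where
  boundary : F → Finset (Sym2 V)
  boundary_subset (f : F) : (boundary f : Set (Sym2 V)) ⊆ G.edgeSet
  boundary_nonempty (f : F) : (boundary f).Nonempty
  isEven_boundary (f : F) : IsEven (boundary f)
  exists_faces_of_edge : ∀ e ∈ G.edgeSet, ∃ f g, f ≠ g ∧ ∀ h, e ∈ boundary h ↔ h = f ∨ h = g
  eq_of_mem_boundary {f g : F} (hfg : f ≠ g) {e e' : Sym2 V} (hef : e ∈ boundary f)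
    (heg : e ∈ boundary g) (hef' : e' ∈ boundary f) (heg' : e' ∈ boundary g) : e = e'

namespace FaceSystem

section Discharging

variable {V F : Type*} {G : SimpleGraph V} (S : FaceSystem G F)

/-- Two different faces are neighbours if they share an edge. -/
def Neighbours (f g : F) : Prop :=
  f ≠ g ∧ ∃ e ∈ S.boundary f, e ∈ S.boundary g

variable {S} in
theorem not_isDiag_of_mem_boundary {f : F} {e : Sym2 V} (he : e ∈ S.boundary f) : ¬ e.IsDiag :=
  G.not_isDiag_of_mem_edgeSet (S.boundary_subset f he)

theorem exists_ne_mem_boundary {f : F} {e : Sym2 V} (he : e ∈ S.boundary f) :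
    ∃ g, f ≠ g ∧ e ∈ S.boundary g := by
  obtain ⟨g, h, hgh, mem_iff⟩ := S.exists_faces_of_edge e (S.boundary_subset f he)
  rcases (mem_iff f).1 he with rfl | rfl
  · exact ⟨h, hgh, (mem_iff h).2 (Or.inr rfl)⟩
  · exact ⟨g, hgh.symm, (mem_iff g).2 (Or.inl rfl)⟩

theorem sum_card_boundary [Fintype F] [Fintype G.edgeSet] :
    ∑ f, #(S.boundary f) = 2 * #G.edgeFinset := by
  classical
  calc ∑ f, #(S.boundary f) = ∑ f, #{e ∈ G.edgeFinset | e ∈ S.boundary f} := by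
        refine sum_congr rfl fun f _ => ?_
        rw [filter_mem_eq_inter, inter_eq_right.2 fun e he =>
          SimpleGraph.mem_edgeFinset.2 (S.boundary_subset f he)]
    _ = ∑ e ∈ G.edgeFinset, #{f | e ∈ S.boundary f} :=
      sum_card_bipartiteAbove_eq_sum_card_bipartiteBelow fun f e => e ∈ S.boundary f
    _ = ∑ e ∈ G.edgeFinset, 2 := by
      refine sum_congr rfl fun e he => ?_
      obtain ⟨f, g, hfg, mem_iff⟩ := S.exists_faces_of_edge e (SimpleGraph.mem_edgeFinset.1 he)
      exact card_eq_two.2 ⟨f, g, hfg, by ext h; simp [mem_iff]⟩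
    _ = 2 * #G.edgeFinset := by rw [sum_const, smul_eq_mul, mul_comm]

open scoped Classical in
theorem card_boundary_le_card_neighbours [Fintype F] (f : F) :
    #(S.boundary f) ≤ #{g | S.Neighbours f g} := by
  have : Nonempty F := ⟨f⟩
  choose! φ hφne hφ using fun e he => S.exists_ne_mem_boundary (f := f) (e := e) he
  refine card_le_card_of_injOn φ (fun e he => ?_) fun e he e' he' heq => ?_
  · exact mem_filter.2 ⟨mem_univ _, hφne e he, e, he, hφ e he⟩
  · exact S.eq_of_mem_boundary (hφne e he) he (hφ e he) he' (heq ▸ hφ e' he')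

section

variable [Finite V]

theorem three_le_card_boundary (f : F) : 3 ≤ #(S.boundary f) :=
  (S.isEven_boundary f).three_le_card (S.boundary_subset f) (S.boundary_nonempty f)

theorem boundary_injective : Function.Injective S.boundary := by
  intro f g h
  by_contra hfg
  obtain ⟨e, he, e', he', hne⟩ := one_lt_card.1 (Nat.lt_of_succ_lt (S.three_le_card_boundary f))
  exact hne (S.eq_of_mem_boundary hfg he (h ▸ he) he' (h ▸ he'))

theorem exists_isCycleOfLength {f : F} (hf : #(S.boundary f) < 6) :
    ∃ C : G.Subgraph, IsCycleOfLength #(S.boundary f) C ∧ C.edgeSet = S.boundary f :=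
  (S.isEven_boundary f).exists_isCycleOfLength (S.boundary_subset f) (S.boundary_nonempty f) hf

variable {S}

theorem eq_of_card_boundary_eq_three (hT : DisjointTriangles G) {f g : F}
    (hf : #(S.boundary f) = 3) (hg : #(S.boundary g) = 3) {e e' : Sym2 V} (he : e ∈ S.boundary f)
    (he' : e' ∈ S.boundary g) {u : V} (hu : u ∈ e) (hu' : u ∈ e') : f = g := by
  obtain ⟨T, hT₁, edgeSet_eq₁⟩ := S.exists_isCycleOfLength (f := f) (by lia)
  obtain ⟨T', hT₂, edgeSet_eq₂⟩ := S.exists_isCycleOfLength (f := g) (by lia)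
  rw [hf] at hT₁
  rw [hg] at hT₂
  have triangles_eq : T = T' := by
    by_contra hne
    refine hT T T' hT₁ hT₂ hne ⟨u, ?_, ?_⟩
    · exact T.mem_verts_of_mem_edge (edgeSet_eq₁ ▸ he) hu
    · exact T'.mem_verts_of_mem_edge (edgeSet_eq₂ ▸ he') hu'
  exact S.boundary_injective (coe_injective (edgeSet_eq₁ ▸ edgeSet_eq₂ ▸ triangles_eq ▸ rfl))

theorem Neighbours.card_boundary_ne_three (hT : DisjointTriangles G) {f g : F}
    (hfg : S.Neighbours f g) (hf : #(S.boundary f) = 3) : #(S.boundary g) ≠ 3 := by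
  obtain ⟨hne, e, hef, heg⟩ := hfg
  exact fun hg => hne (eq_of_card_boundary_eq_three hT hf hg hef heg e.out_fst_mem e.out_fst_mem)

theorem Neighbours.eq_of_card_boundary_eq_four (hC : FewAdjacentFourCycles G) {f g h : F}
    (hfg : S.Neighbours f g) (hfh : S.Neighbours f h) (hf : #(S.boundary f) = 3)
    (hg : #(S.boundary g) = 4) (hh : #(S.boundary h) = 4) : g = h := by
  obtain ⟨T, hT, edgeSet_eq⟩ := S.exists_isCycleOfLength (f := f) (by lia)
  obtain ⟨C, hC₁, edgeSet_eq₁⟩ := S.exists_isCycleOfLength (f := g) (by lia)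
  obtain ⟨C', hC₂, edgeSet_eq₂⟩ := S.exists_isCycleOfLength (f := h) (by lia)
  rw [hf] at hT
  rw [hg] at hC₁
  rw [hh] at hC₂
  obtain ⟨-, e, hef, heg⟩ := hfg
  obtain ⟨-, e', hef', heh⟩ := hfh
  have cycles_eq : C = C' := Set.encard_le_one_iff.1 (hC T hT) C C'
    ⟨hC₁, e, edgeSet_eq ▸ hef, edgeSet_eq₁ ▸ heg⟩ ⟨hC₂, e', edgeSet_eq ▸ hef', edgeSet_eq₂ ▸ heh⟩
  exact S.boundary_injective (coe_injective (edgeSet_eq₁ ▸ edgeSet_eq₂ ▸ cycles_eq ▸ rfl))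

variable [Fintype F]

open scoped Classical in
theorem two_le_card_large_neighbours (hT : DisjointTriangles G) (hC : FewAdjacentFourCycles G)
    {f : F} (hf : #(S.boundary f) = 3) :
    2 ≤ #{g | 5 ≤ #(S.boundary g) ∧ S.Neighbours f g} := by
  have four_faces : #{g | S.Neighbours f g ∧ #(S.boundary g) = 4} ≤ 1 := by
    refine card_le_one.2 fun g hg h hh => ?_
    obtain ⟨-, hg, hg₄⟩ := mem_filter.1 hg
    obtain ⟨-, hh, hh₄⟩ := mem_filter.1 hh
    exact hg.eq_of_card_boundary_eq_four hC hh hf hg₄ hh₄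
  have subset : ({g | S.Neighbours f g} : Finset F) ⊆
      ({g | S.Neighbours f g ∧ #(S.boundary g) = 4} : Finset F) ∪
        ({g | 5 ≤ #(S.boundary g) ∧ S.Neighbours f g} : Finset F) := by
    intro g hg
    have hfg := (mem_filter.1 hg).2
    have ne_three := hfg.card_boundary_ne_three hT hf
    have three_le := S.three_le_card_boundary g
    simp only [mem_union, mem_filter_univ, hfg, true_and, and_true]
    lia
  have three_le_union := (S.card_boundary_le_card_neighbours f).trans
    ((card_le_card subset).trans (card_union_le _ _))
  lia

open scoped Classical in
theorem two_mul_card_triangular_neighbours_le (hT : DisjointTriangles G) (g : F) :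
    2 * #{f | #(S.boundary f) = 3 ∧ S.Neighbours f g} ≤ #(S.boundary g) := by
  set N : Finset F := {f | #(S.boundary f) = 3 ∧ S.Neighbours f g}
  have exists_common (f : F) (hf : f ∈ N) : ∃ e ∈ S.boundary f, e ∈ S.boundary g :=
    (mem_filter_univ f).1 hf |>.2.2
  have card_eq_three (f : F) (hf : f ∈ N) : #(S.boundary f) = 3 := ((mem_filter_univ f).1 hf).1
  have : Nonempty (Sym2 V) := ⟨(S.boundary_nonempty g).choose⟩
  choose! ψ hψ hψg using exists_common
  have ψ_eq {f f' : F} (hf : f ∈ N) (hf' : f' ∈ N) {u : V} (hu : u ∈ ψ f) (hu' : u ∈ ψ f') :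
      f = f' :=
    eq_of_card_boundary_eq_three hT (card_eq_three f hf) (card_eq_three f' hf') (hψ f hf)
      (hψ f' hf') hu hu'
  have ψ_injOn : Set.InjOn ψ N := fun f hf f' hf' h =>
    ψ_eq hf hf' (ψ f).out_fst_mem (h ▸ (ψ f).out_fst_mem)
  rw [← card_image_of_injOn ψ_injOn]
  refine (S.isEven_boundary g).two_mul_card_le (fun e => not_isDiag_of_mem_boundary) ?_ ?_
  · exact image_subset_iff.2 hψg
  · simp only [forall_mem_image]
    exact fun f hf f' hf' u hu hu' => congrArg ψ (ψ_eq hf hf' hu hu')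

open scoped Classical in
theorem two_mul_card_triangular_le (hT : DisjointTriangles G) (hC : FewAdjacentFourCycles G) :
    2 * #{f | #(S.boundary f) = 3} ≤
      ∑ g with 5 ≤ #(S.boundary g), #{f | #(S.boundary f) = 3 ∧ S.Neighbours f g} := by
  calc 2 * #{f | #(S.boundary f) = 3}
      ≤ ∑ f with #(S.boundary f) = 3, #{g | 5 ≤ #(S.boundary g) ∧ S.Neighbours f g} := by
        rw [mul_comm, ← smul_eq_mul]
        exact card_nsmul_le_sum _ _ _ fun f hf =>
          two_le_card_large_neighbours hT hC ((mem_filter_univ f).1 hf)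
    _ = ∑ g with 5 ≤ #(S.boundary g), #{f | #(S.boundary f) = 3 ∧ S.Neighbours f g} := by
      simp only [← filter_filter]
      exact sum_card_bipartiteAbove_eq_sum_card_bipartiteBelow S.Neighbours

theorem two_mul_card_le_card_edgeFinset [Fintype G.edgeSet] (S : FaceSystem G F)
    (hT : DisjointTriangles G) (hC : FewAdjacentFourCycles G) :
    2 * Fintype.card F ≤ #G.edgeFinset := by
  classical
  let t (g : F) : ℕ := #{f | #(S.boundary f) = 3 ∧ S.Neighbours f g}
  -- Every face `f` starts with charge `2 * #(S.boundary f) - 8`; a face of length at least five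
  -- gives one unit to each triangular neighbour, hence at most `#(S.boundary f) / 2` in total.
  have charge (f : F) : 8 + (if 5 ≤ #(S.boundary f) then t f else 0) ≤
      2 * #(S.boundary f) + 2 * (if #(S.boundary f) = 3 then 1 else 0) := by
    have three_le := S.three_le_card_boundary f
    have ht : 2 * t f ≤ #(S.boundary f) := two_mul_card_triangular_neighbours_le hT f
    split_ifs <;> lia
  have total := sum_le_sum fun f (_ : f ∈ univ) => charge f
  rw [sum_add_distrib, sum_add_distrib, ← sum_filter, ← mul_sum, ← mul_sum, sum_boole,
    S.sum_card_boundary, sum_const, card_univ, smul_eq_mul, Nat.cast_id] at total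
  have received : 2 * #{f | #(S.boundary f) = 3} ≤ ∑ g with 5 ≤ #(S.boundary g), t g :=
    two_mul_card_triangular_le hT hC
  lia

end

end Discharging

end FaceSystem

section FacesOfLabelling

variable {V W : Type*} {G : SimpleGraph V} [Fintype G.edgeSet] [AddCommGroup W]

open scoped Classical in
/-- The set of the labels that occur on the two sides of the edges. -/
noncomputable def faceLabels (ζ A : G.edgeSet → W) : Finset W :=
  univ.image A ∪ univ.image (A + ζ)

open scoped Classical in
/-- The edges with the label `f` on one of their sides. -/
noncomputable def faceBoundary (ζ A : G.edgeSet → W) (f : W) : Finset (Sym2 V) :=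
  ({e | A e = f ∨ A e + ζ e = f} : Finset G.edgeSet).map (Function.Embedding.subtype _)

variable {ζ A : G.edgeSet → W}

theorem label_mem_faceLabels (e : G.edgeSet) : A e ∈ faceLabels ζ A := by
  classical
  exact mem_union_left _ (mem_image_of_mem A (mem_univ e))

theorem label_add_mem_faceLabels (e : G.edgeSet) : A e + ζ e ∈ faceLabels ζ A := by
  classical
  exact mem_union_right _ (mem_image_of_mem (A + ζ) (mem_univ e))

theorem mem_faceBoundary {f : W} {e : Sym2 V} :
    e ∈ faceBoundary ζ A f ↔ ∃ h : e ∈ G.edgeSet, A ⟨e, h⟩ = f ∨ A ⟨e, h⟩ + ζ ⟨e, h⟩ = f := by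
  simp [faceBoundary]

theorem faceBoundary_nonempty {f : W} (hf : f ∈ faceLabels ζ A) :
    (faceBoundary ζ A f).Nonempty := by
  classical
  rcases mem_union.1 hf with hf | hf
  · obtain ⟨e, -, rfl⟩ := mem_image.1 hf
    exact ⟨e, mem_faceBoundary.2 ⟨e.2, Or.inl rfl⟩⟩
  · obtain ⟨e, -, rfl⟩ := mem_image.1 hf
    exact ⟨e, mem_faceBoundary.2 ⟨e.2, Or.inr rfl⟩⟩

theorem eq_sub_of_mem_faceBoundary [Module (ZMod 2) W] {f g : W} (hfg : f ≠ g) {e : Sym2 V}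
    (hf : e ∈ faceBoundary ζ A f) (hg : e ∈ faceBoundary ζ A g) :
    ∃ h : e ∈ G.edgeSet, ζ ⟨e, h⟩ = f - g := by
  obtain ⟨he, hf⟩ := mem_faceBoundary.1 hf
  obtain ⟨_, hg⟩ := mem_faceBoundary.1 hg
  refine ⟨he, ?_⟩
  rcases hf with hf | hf <;> rcases hg with hg | hg
  · exact absurd (hf.symm.trans hg) hfg
  · rw [← hf, ← hg, sub_add_cancel_left, ZModModule.neg_eq_self]
  · rw [← hf, ← hg, add_sub_cancel_left]
  · exact absurd (hf.symm.trans hg) hfg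

theorem IsFaceLabelling.isEven_faceBoundary
    (hA : IsFaceLabelling (fun e : G.edgeSet => (e : Sym2 V)) ζ A) (hζ : ∀ e, ζ e ≠ 0) (f : W) :
    IsEven (faceBoundary ζ A f) := by
  classical
  intro u
  have hsum := isCirculation_iff.1 (hA fun x => if x = f then 1 else 0) u
  have not_both (e : G.edgeSet) : ¬ (A e = f ∧ A e + ζ e = f) :=
    fun h => hζ e (left_eq_add.1 (h.1.trans h.2.symm))
  rw [← ZMod.natCast_eq_zero_iff_even, ← hsum]
  calc (#{e ∈ faceBoundary ζ A f | u ∈ e} : ZMod 2)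
      = #(filter (fun e : G.edgeSet => A e = f ∨ A e + ζ e = f) {e | u ∈ (e : Sym2 V)}) := by
        rw [faceBoundary, filter_map, card_map, filter_comm]
        rfl
    _ = ∑ e ∈ ({e | u ∈ (e : Sym2 V)} : Finset G.edgeSet),
          if A e = f ∨ A e + ζ e = f then 1 else 0 := natCast_card_filter _ _
    _ = _ := by
      refine sum_congr rfl fun e _ => ?_
      have := not_both e
      split_ifs <;> simp_all

/-- The face system whose faces are the labels of the sides of the edges. -/
noncomputable def IsFaceLabelling.faceSystem [Module (ZMod 2) W]
    (hA : IsFaceLabelling (fun e : G.edgeSet => (e : Sym2 V)) ζ A) (hζ : ∀ e, ζ e ≠ 0)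
    (hinj : Function.Injective ζ) : FaceSystem G (faceLabels ζ A) where
  boundary f := faceBoundary ζ A f
  boundary_subset f _ he := (mem_faceBoundary.1 he).1
  boundary_nonempty f := faceBoundary_nonempty f.2
  isEven_boundary f := hA.isEven_faceBoundary hζ f
  exists_faces_of_edge e he := by
    refine ⟨⟨_, label_mem_faceLabels ⟨e, he⟩⟩, ⟨_, label_add_mem_faceLabels ⟨e, he⟩⟩, ?_, ?_⟩
    · exact fun h => hζ _ (left_eq_add.1 (congrArg Subtype.val h))
    · intro f
      simp only [mem_faceBoundary, he, exists_true_left, Subtype.ext_iff]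
      exact or_congr eq_comm eq_comm
  eq_of_mem_boundary hfg _ _ hef heg hef' heg' := by
    obtain ⟨_, h⟩ := eq_sub_of_mem_faceBoundary (Subtype.coe_injective.ne hfg) hef heg
    obtain ⟨_, h'⟩ := eq_sub_of_mem_faceBoundary (Subtype.coe_injective.ne hfg) hef' heg'
    exact congrArg Subtype.val (hinj (h.trans h'.symm))

theorem finrank_lt_card_faceLabels {K : Type*} [DivisionRing K] [Module K W] [Nonempty G.edgeSet]
    (hζ : Submodule.span K (Set.range ζ) = ⊤) :
    Module.finrank K W < #(faceLabels ζ A) := by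
  classical
  have span_eq_top : vectorSpan K (faceLabels ζ A : Set W) = ⊤ := by
    rw [eq_top_iff, ← hζ, Submodule.span_le]
    rintro _ ⟨e, rfl⟩
    have := vsub_mem_vectorSpan K (label_add_mem_faceLabels (A := A) (ζ := ζ) e)
      (label_mem_faceLabels e)
    rwa [vsub_eq_sub, add_sub_cancel_left] at this
  have card_pos : 0 < #(faceLabels ζ A) :=
    card_pos.2 ⟨_, label_mem_faceLabels (Classical.arbitrary G.edgeSet)⟩
  have finrank_le := finrank_vectorSpan_image_finset_le K id (faceLabels ζ A)
    (Nat.succ_pred_eq_of_pos card_pos).symm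
  rw [image_id, span_eq_top, finrank_top] at finrank_le
  exact Nat.lt_of_le_pred card_pos finrank_le

theorem PlaneDrawing.exists_faceSystem [Fintype V] [Nonempty V] [Nonempty G.edgeSet]
    (D : PlaneDrawing G) (hG : G.IsEdgeConnected 3) :
    ∃ F : Finset ((G.edgeSet → ZMod 2) ⧸ cutSpace G), Nonempty (FaceSystem G F) ∧
      #G.edgeFinset + 2 ≤ #F + Fintype.card V := by
  obtain ⟨A, hA⟩ := D.exists_isFaceLabelling (isCirculation_edgeClass G)
  have edgeClass_ne_zero := edgeClass_ne_zero fun u v => (hG u v).anti (by norm_num)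
  refine ⟨_, ⟨hA.faceSystem edgeClass_ne_zero (edgeClass_injective hG)⟩, ?_⟩
  have finrank_lt := finrank_lt_card_faceLabels (A := A) (span_range_edgeClass G)
  have finrank_add := (cutSpace G).finrank_quotient_add_finrank
  have finrank_cutSpace_lt := finrank_cutSpace_lt G
  rw [Module.finrank_fintype_fun_eq_card, ← SimpleGraph.edgeFinset_card] at finrank_add
  lia

end FacesOfLabelling

section Comap

variable {V V' : Type*} {G : SimpleGraph V} {H : SimpleGraph V'}

/-- The drawing of a graph induced by an injective homomorphism into a plane graph. -/
def PlaneDrawing.comap (D : PlaneDrawing G) (f : H →g G) (hf : Function.Injective f) :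
    PlaneDrawing H where
  point := D.point ∘ f
  point_injective := D.point_injective.comp hf
  arc e := D.arc (f.mapEdgeSet e)
  arc_ends e := by rw [D.arc_ends, SimpleGraph.Hom.mapEdgeSet_coe, Sym2.map_map]
  mem_of_point_mem_arc e v h := by
    have hmem := D.mem_of_point_mem_arc _ _ h
    rw [SimpleGraph.Hom.mapEdgeSet_coe, Sym2.mem_map] at hmem
    obtain ⟨w, hw, hwv⟩ := hmem
    exact hf hwv ▸ hw
  arc_inter e e' hne x hx hx' := by
    obtain ⟨v, hv, hv', rfl⟩ := D.arc_inter _ _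
      ((SimpleGraph.Hom.mapEdgeSet.injective f hf).ne hne) x hx hx'
    rw [SimpleGraph.Hom.mapEdgeSet_coe, Sym2.mem_map] at hv hv'
    obtain ⟨w, hw, rfl⟩ := hv
    obtain ⟨w', hw', hww'⟩ := hv'
    exact ⟨w, hw, hf hww' ▸ hw', rfl⟩

theorem subgraph_map_injective {f : H →g G} (hf : Function.Injective f) :
    Function.Injective (SimpleGraph.Subgraph.map f) := by
  intro A B h
  have verts_eq : A.verts = B.verts := hf.image_injective (congrArg SimpleGraph.Subgraph.verts h)
  have edgeSet_eq : A.edgeSet = B.edgeSet := by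
    have image_eq := congrArg SimpleGraph.Subgraph.edgeSet h
    rw [SimpleGraph.Subgraph.edgeSet_map, SimpleGraph.Subgraph.edgeSet_map] at image_eq
    exact (Sym2.map.injective hf).image_injective image_eq
  refine SimpleGraph.Subgraph.ext verts_eq ?_
  ext a b
  rw [← SimpleGraph.Subgraph.mem_edgeSet, edgeSet_eq, SimpleGraph.Subgraph.mem_edgeSet]

theorem IsCycleOfLength.map {k : ℕ} {C : H.Subgraph} (hC : IsCycleOfLength k C) {f : H →g G}
    (hf : Function.Injective f) : IsCycleOfLength k (C.map f) := by
  obtain ⟨u, w, hw, rfl, rfl⟩ := hC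
  exact ⟨f u, w.map f, hw.map hf, w.length_map f, (w.toSubgraph_map f).symm⟩

theorem Adjacent.map {A B : H.Subgraph} (h : Adjacent A B) (f : H →g G) :
    Adjacent (A.map f) (B.map f) := by
  rw [Adjacent, SimpleGraph.Subgraph.edgeSet_map, SimpleGraph.Subgraph.edgeSet_map]
  exact (Set.Nonempty.image (Sym2.map f) h).mono (Set.image_inter_subset _ _ _)

theorem DisjointTriangles.comap (hG : DisjointTriangles G) {f : H →g G}
    (hf : Function.Injective f) : DisjointTriangles H := by
  rintro A B hA hB hne ⟨v, hvA, hvB⟩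
  exact hG _ _ (IsCycleOfLength.map hA hf) (IsCycleOfLength.map hB hf)
    ((subgraph_map_injective hf).ne hne) ⟨f v, ⟨v, hvA, rfl⟩, ⟨v, hvB, rfl⟩⟩

theorem FewAdjacentFourCycles.comap (hG : FewAdjacentFourCycles G) {f : H →g G}
    (hf : Function.Injective f) : FewAdjacentFourCycles H := by
  intro T hT
  have mapsTo : Set.MapsTo (SimpleGraph.Subgraph.map f)
      {C | IsCycleOfLength 4 C ∧ Adjacent T C} {C | IsCycleOfLength 4 C ∧ Adjacent (T.map f) C} :=
    fun _ hC => ⟨hC.1.map hf, hC.2.map f⟩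
  exact (Set.encard_le_encard_of_injOn mapsTo (subgraph_map_injective hf).injOn).trans
    (hG _ (IsCycleOfLength.map hT hf))

end Comap

section EdgeBound

variable {V : Type*} [Finite V] {G : SimpleGraph V}

theorem ncard_edgeSet_le_of_cut_subset {S : Set V} {T : Set (Sym2 V)}
    (hT : ∀ a ∈ S, ∀ b ∉ S, G.Adj a b → s(a, b) ∈ T) : G.edgeSet.ncard ≤
      (G.induce S).edgeSet.ncard + (G.induce Sᶜ).edgeSet.ncard + T.ncard := by
  let inside (R : Set V) : Set (Sym2 V) := Sym2.map Subtype.val '' (G.induce R).edgeSet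
  have mem_inside {R : Set V} {a b : V} (ha : a ∈ R) (hb : b ∈ R) (hab : G.Adj a b) :
      s(a, b) ∈ inside R := ⟨s(⟨a, ha⟩, ⟨b, hb⟩), hab, rfl⟩
  have edges_subset : G.edgeSet ⊆ inside S ∪ inside Sᶜ ∪ T := by
    intro e
    induction e with | _ a b
    intro hab
    by_cases ha : a ∈ S <;> by_cases hb : b ∈ S
    · exact Or.inl (Or.inl (mem_inside ha hb hab))
    · exact Or.inr (hT a ha b hb hab)
    · exact Or.inr (Sym2.eq_swap (a := a) ▸ hT b hb a ha (SimpleGraph.Adj.symm hab))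
    · exact Or.inl (Or.inr (mem_inside ha hb hab))
  calc G.edgeSet.ncard ≤ (inside S ∪ inside Sᶜ ∪ T).ncard := Set.ncard_le_ncard edges_subset
    _ ≤ (inside S).ncard + (inside Sᶜ).ncard + T.ncard :=
      (Set.ncard_union_le _ _).trans (by gcongr; exact Set.ncard_union_le _ _)
    _ ≤ _ := by gcongr <;> exact Set.ncard_image_le

theorem exists_ncard_edgeSet_lt_of_not_isEdgeConnected {k : ℕ} (hG : ¬ G.IsEdgeConnected k) :
    ∃ S : Set V, S.Nonempty ∧ Sᶜ.Nonempty ∧ G.edgeSet.ncard <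
      (G.induce S).edgeSet.ncard + (G.induce Sᶜ).edgeSet.ncard + k := by
  simp only [SimpleGraph.IsEdgeConnected, SimpleGraph.IsEdgeReachable, not_forall] at hG
  obtain ⟨u, v, T, hTk, huv⟩ := hG
  let S : Set V := {x | (G.deleteEdges T).Reachable u x}
  refine ⟨S, ⟨u, .rfl⟩, ⟨v, huv⟩, ?_⟩
  have cut_subset : ∀ a ∈ S, ∀ b ∉ S, G.Adj a b → s(a, b) ∈ T := by
    intro a ha b hb hab
    by_contra habT
    exact hb (SimpleGraph.Reachable.trans ha (SimpleGraph.deleteEdges_adj.2 ⟨hab, habT⟩).reachable)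
  have hTk : T.ncard < k := by
    rwa [← T.toFinite.cast_ncard_eq, Nat.cast_lt] at hTk
  exact (ncard_edgeSet_le_of_cut_subset cut_subset).trans_lt (by gcongr)

theorem PlaneDrawing.ncard_edgeSet_add_four_le [Nonempty V] (D : PlaneDrawing G)
    (hE : G.edgeSet.Nonempty) (hG : G.IsEdgeConnected 3) (hT : DisjointTriangles G)
    (hC : FewAdjacentFourCycles G) : G.edgeSet.ncard + 4 ≤ 2 * Nat.card V := by
  classical
  cases nonempty_fintype V
  have : Nonempty G.edgeSet := hE.to_subtype
  obtain ⟨F, ⟨S⟩, euler⟩ := D.exists_faceSystem hG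
  have discharging := S.two_mul_card_le_card_edgeFinset hT hC
  rw [Fintype.card_coe] at discharging
  rw [← SimpleGraph.coe_edgeFinset, Set.ncard_coe_finset, Nat.card_eq_fintype_card]
  lia

theorem PlaneDrawing.ncard_edgeSet_add_two_le [Nonempty V] (D : PlaneDrawing G)
    (hT : DisjointTriangles G) (hC : FewAdjacentFourCycles G) :
    G.edgeSet.ncard + 2 ≤ 2 * Nat.card V := by
  induction hn : Nat.card V using Nat.strong_induction_on generalizing V with
  | _ n ih =>
  subst hn
  by_cases hG : G.IsEdgeConnected 3
  · rcases G.edgeSet.eq_empty_or_nonempty with hE | hE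
    · rw [hE, Set.ncard_empty]
      have := Nat.card_pos (α := V)
      lia
    · have := D.ncard_edgeSet_add_four_le hE hG hT hC
      lia
  · obtain ⟨S, hS, hS', edges_lt⟩ := exists_ncard_edgeSet_lt_of_not_isEdgeConnected hG
    have card_add := Set.ncard_add_ncard_compl S
    have card_pos := (Set.ncard_pos).2 hS
    have card_compl_pos := (Set.ncard_pos).2 hS'
    have induced_bound (R : Set V) (hR : R.Nonempty) (hlt : R.ncard < Nat.card V) :
        (G.induce R).edgeSet.ncard + 2 ≤ 2 * R.ncard := by
      have : Nonempty R := hR.to_subtype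
      let ι : G.induce R →g G := (SimpleGraph.Embedding.induce R).toHom
      have hι : Function.Injective ι := Subtype.val_injective
      exact ih _ hlt (D.comap ι hι) (hT.comap hι) (hC.comap hι) (Nat.card_coe_set_eq R)
    have bound := induced_bound S hS (by lia)
    have bound_compl := induced_bound Sᶜ hS' (by lia)
    lia

theorem PlaneDrawing.averageDegree_lt_four (D : PlaneDrawing G) (hT : DisjointTriangles G)
    (hC : FewAdjacentFourCycles G) {H : G.Subgraph} (hH : H.verts.Nonempty) :
    averageDegree H < 4 := by
  have : Nonempty H.verts := hH.to_subtype
  have hinj := H.hom_injective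
  have coe_bound := (D.comap H.hom hinj).ncard_edgeSet_add_two_le (hT.comap hinj) (hC.comap hinj)
  have ncard_edgeSet : H.coe.edgeSet.ncard = H.edgeSet.ncard := by
    rw [← H.image_coe_edgeSet_coe,
      Set.ncard_image_of_injective _ (Sym2.map.injective Subtype.coe_injective)]
  rw [ncard_edgeSet, Nat.card_coe_set_eq] at coe_bound
  have verts_pos : (0 : ℝ) < H.verts.ncard := by exact_mod_cast (Set.ncard_pos).2 hH
  rw [averageDegree, div_lt_iff₀ verts_pos]
  norm_cast
  lia

end EdgeBound

end PlanarMad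

theorem theorem3p2 {V : Type*} [Finite V] (G : SimpleGraph V)
    (hplanar : PlanarMad.IsPlanar G)
    (htriangles : ∀ T₁ T₂ : G.Subgraph, PlanarMad.IsTriangle T₁ → PlanarMad.IsTriangle T₂ →
      T₁ ≠ T₂ → ¬ PlanarMad.Intersecting T₁ T₂)
    (hfour : ∀ T : G.Subgraph, PlanarMad.IsTriangle T →
      {C : G.Subgraph | PlanarMad.IsCycleOfLength 4 C ∧ PlanarMad.Adjacent T C}.encard ≤ 1) :
    PlanarMad.mad G < 4 := by
  obtain ⟨D⟩ := hplanar
  rcases isEmpty_or_nonempty V with hV | hV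
  · have no_subgraph :
        {d : ℝ | ∃ H : G.Subgraph, H.verts.Nonempty ∧ d = PlanarMad.averageDegree H} = ∅ :=
      Set.eq_empty_of_forall_notMem fun _ ⟨_, ⟨v, _⟩, _⟩ => hV.elim v
    rw [PlanarMad.mad, no_subgraph, Real.sSup_empty]
    norm_num
  · obtain ⟨H, hH, mad_eq⟩ := (PlanarMad.isGreatest_mad G).1
    exact mad_eq ▸ D.averageDegree_lt_four htriangles hfour hH
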